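/- Let $\mathbf{Comp}$ be the class of compact Hausdorff spaces. A \emph{cover} of $X\in\mathbf{Comp}$ is a pair $(Y,f)$ with $Y\in\mathbf{Comp}$ and $f\colon Y\to X$ a perfect irreducible continuous surjection (irreducible: $f(F)\ne X$ for every proper closed $F\subset Y$); $(Y_1,f_1)\le (Y_2,f_2)$ means $f_2=f_1\circ g$ for some continuous $g\colon Y_2\to Y_1$. A \emph{covering operator} $c$ assigns to each $X\in\mathbf{Comp}$ a cover $(cX,c_X)$ which is the minimum of the covers $(Y,f)$ of $X$ with $Y\in\mathrm{fix}(c)=\{Z : c_Z \text{ is a homeomorphism}\}$ (in particular $cX\in\mathrm{fix}(c)$). Let $\mathbf{W}^*$ be the category of Archimedean real vector lattices with distinguished strong unit and unit-preserving vector lattice homomorphisms. An \emph{essential extension} of $A$ is a pair $(B,f)$ with $f\colon A\to B$ an injective $\mathbf{W}^*$-morphism such that any $\mathbf{W}^*$-morphism $g\colon B\to C$ with $g\circ f$ injective is injective; $(B_1,f_1)\le(B_2,f_2)$ means $f_2=g\circ f_1$ for some $\mathbf{W}^*$-morphism $g\colon B_1\to B_2$. A \emph{hull operator} $h$ assigns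 to each $A\in\mathbf{W}^*$ an essential extension $(hA,h_A)$ which is the minimum of the essential extensions $(B,f)$ of $A$ with $B\in\mathrm{fix}(h)=\{D : h_D\text{ is an isomorphism}\}$ (in particular $hA\in\mathrm{fix}(h)$). Covering operators (forming $\mathbf{coComp}$) and hull operators (forming $\mathbf{hoW}^*$) are ordered pointwise, and two operators are identified if each is $\le$ the other, i.e. if they pick equivalent covers (extensions) everywhere. For $A\in\mathbf{W}^*$ with unit $u_A$, let $YA$ be the (compact Hausdorff) Yosida space of ideals of $A$ maximal with respect to not containing $u_A$, with the hull-kernel topology, and let $\nu_A\colon A\to C(YA)$ be the Yosida representation: $\nu_A(a)(M)$ is the real $r$ with $a-r u_A\in M$. Here $C(X)$ is the vector lattice of continuous real functions on $X$, with unit $1$. Let $u$ be the uniform completion operator, $uA=C(YA)$ with embedding $\nu_A$. For $c\in\mathbf{coComp}$ let $\mu(c)A=C(cYA)$, with $\mu(c)_A(a)=\nu_A(a)\circ c_{YA}$. Let $r$ be the ring reflection: each $rA$ carries an $f$-ring multiplication with the unit as identity, and each $\mathbf{W}^*$-morphism from $A$ to an object $R$ that carries such a multiplication extends uniquely over $r_A\colon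 A\to rA$ to a $\mathbf{W}^*$-morphism $rA\to R$. Let $p$ be the projectable hull: $(pA,p_A)$ is the minimum among the essential extensions $(B,f)$ of $A$ with $B$ projectable (i.e. $B=b^{\perp\perp}+b^{\perp}$ for every $b\in B$). \textbf{Theorem.} (i) $\mu$ is order-preserving and injective on $\mathbf{coComp}$. (ii) $u\in\mathbf{hoW}^*$, and for every $c\in\mathbf{coComp}$, $\mu(c)\in\mathbf{hoW}^*$ and $u\le\mu(c)$. (iii) $\mu\colon\mathbf{coComp}\to\mathbf{hoW}^*$ is not onto: the ring reflection $r$ and the projectable hull $p$ exist and are members of $\mathbf{hoW}^*$, and neither is in the range of $\mu$. -/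

import Mathlib

/-!
# Covering operators, hull operators, and the Yosida map `μ`
-/

universe u

noncomputable section

/-! ## Covers and covering operators on compact Hausdorff spaces -/

/-- A space over `X`: a compact Hausdorff space with a continuous map to `X`. -/
structure OverSpace (X : CompHaus.{u}) : Type (u + 1) where
  space : CompHaus.{u}
  map : C(space, X)

namespace OverSpace

variable {X : CompHaus.{u}}

/-- `(Y, f)` is a cover of `X`: `f` is a perfect irreducible continuous surjection. -/
structure IsCover (P : OverSpace X) : Prop where
  surjective : Function.Surjective P.map
  isClosedMap : IsClosedMap P.map
  isCompact_fiber : ∀ x : X, IsCompact (P.map ⁻¹' {x})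
  irreducible : ∀ F : Set P.space, IsClosed F → P.map '' F = Set.univ → F = Set.univ

/-- `(Y₁, f₁) ≤ (Y₂, f₂)` if `f₂ = f₁ ∘ g` for some continuous `g : Y₂ → Y₁`. -/
instance : LE (OverSpace X) where
  le P Q := ∃ g : C(Q.space, P.space), Q.map = P.map.comp g

end OverSpace

/-- The data of a covering operator: for every `X` a space over `X`. -/
abbrev CoverAssignment : Type (u + 1) := ∀ X : CompHaus.{u}, OverSpace X

/-- `X ∈ fix(c)`: the map `c_X : cX → X` is a homeomorphism. -/
def CoverAssignment.Fix (c : CoverAssignment.{u}) (X : CompHaus.{u}) : Prop :=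
  IsHomeomorph (c X).map

/-- `c` is a covering operator: for every `X`, the pair `(cX, c_X)` is a cover of `X`, and it is
the minimum among the covers `(Y, f)` of `X` with `Y ∈ fix(c)`. The order of the class of covering
operators is the pointwise one, `∀ X, c X ≤ d X`. -/
structure IsCoveringOperator (c : CoverAssignment.{u}) : Prop where
  isCover : ∀ X, (c X).IsCover
  fix : ∀ X, c.Fix (c X).space
  minimum : ∀ X (P : OverSpace X), P.IsCover → c.Fix P.space → c X ≤ P

/-! ## Archimedean vector lattices with strong unit -/

/-- Archimedean (real) vector lattices with a distinguished strong unit. -/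
structure Wstar : Type (u + 1) where
  carrier : Type u
  [instAddCommGroup : AddCommGroup carrier]
  [instModule : Module ℝ carrier]
  [instLattice : Lattice carrier]
  [instIsOrderedAddMonoid : IsOrderedAddMonoid carrier]
  [instPosSMulMono : PosSMulMono ℝ carrier]
  archimedean : ∀ x y : carrier, 0 ≤ x → (∀ n : ℕ, n • x ≤ y) → x = 0
  unit : carrier
  unit_nonneg : 0 ≤ unit
  strong : ∀ x : carrier, ∃ n : ℕ, |x| ≤ n • unit

namespace Wstar

instance : CoeSort Wstar.{u} (Type u) := ⟨Wstar.carrier⟩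

attribute [instance] instAddCommGroup instModule instLattice instIsOrderedAddMonoid
  instPosSMulMono

/-- Morphisms: unit-preserving vector lattice homomorphisms. -/
structure Hom (A B : Wstar.{u}) extends A →ₗ[ℝ] B where
  map_sup : ∀ x y, toFun (x ⊔ y) = toFun x ⊔ toFun y
  map_inf : ∀ x y, toFun (x ⊓ y) = toFun x ⊓ toFun y
  map_unit : toFun A.unit = B.unit

instance (A B : Wstar.{u}) : CoeFun (Hom A B) (fun _ => A → B) := ⟨fun f => f.toFun⟩

/-- Composition, first `f` and then `g`. -/
def Hom.comp {A B C : Wstar.{u}} (g : Hom B C) (f : Hom A B) : Hom A C where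
  toLinearMap := g.toLinearMap.comp f.toLinearMap
  map_sup x y := (congrArg g (f.map_sup x y)).trans (g.map_sup _ _)
  map_inf x y := (congrArg g (f.map_inf x y)).trans (g.map_inf _ _)
  map_unit := (congrArg g f.map_unit).trans g.map_unit

/-- `f : A → B` is an essential embedding: it is injective, and every morphism `g : B → C` such
that `g ∘ f` is injective is itself injective. -/
structure Hom.IsEssential {A B : Wstar.{u}} (f : Hom A B) : Prop where
  injective : Function.Injective f
  essential : ∀ (C : Wstar.{u}) (g : Hom B C),
    Function.Injective (g.comp f) → Function.Injective g

/-- An object under `A`: an object `B` with a morphism `A → B`. It is an essential extension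
of `A` when that morphism is an essential embedding. -/
structure Under (A : Wstar.{u}) : Type (u + 1) where
  obj : Wstar.{u}
  map : Hom A obj

/-- `(B₁, f₁) ≤ (B₂, f₂)` if `f₂ = g ∘ f₁` for some morphism `g : B₁ → B₂`. -/
instance (A : Wstar.{u}) : LE (Under A) where
  le P Q := ∃ g : Hom P.obj Q.obj, Q.map = g.comp P.map

end Wstar

/-- The data of a hull operator: for every `A` an object under `A`. -/
abbrev HullAssignment : Type (u + 1) := ∀ A : Wstar.{u}, Wstar.Under A

/-- `A ∈ fix(h)`: the morphism `h_A : A → hA` is an isomorphism (a bijective morphism). -/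
def HullAssignment.Fix (h : HullAssignment.{u}) (A : Wstar.{u}) : Prop :=
  Function.Bijective (h A).map

/-- `h` is a hull operator: for every `A`, the pair `(hA, h_A)` is an essential extension of `A`,
and it is the minimum among the essential extensions `(B, f)` of `A` with `B ∈ fix(h)`. The order
of the class of hull operators is the pointwise one, `∀ A, h A ≤ k A`. -/
structure IsHullOperator (h : HullAssignment.{u}) : Prop where
  isEssential : ∀ A, (h A).map.IsEssential
  fix : ∀ A, h.Fix (h A).obj
  minimum : ∀ A (P : Wstar.Under A), P.map.IsEssential → h.Fix P.obj → h A ≤ P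

/-! ## The Yosida space and the Yosida representation -/

namespace Wstar

variable {A : Wstar.{u}}

/-- (Order) ideals: solid linear subspaces. -/
def IsIdeal (I : Submodule ℝ A) : Prop := ∀ x y : A, y ∈ I → |x| ≤ |y| → x ∈ I

/-- Ideals that are maximal with respect to not containing the unit. -/
structure IsUnitMaximal (M : Submodule ℝ A) : Prop where
  isIdeal : IsIdeal M
  unit_notMem : A.unit ∉ M
  maximal : ∀ I : Submodule ℝ A, IsIdeal I → A.unit ∉ I → M ≤ I → I = M

variable (A) in
/-- The points of the Yosida space. -/
def MaxIdeal : Type u := {M : Submodule ℝ A // IsUnitMaximal M}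

/-- The hull-kernel topology: the sets `{M | a ∉ M}` form a subbase (indeed a base). -/
instance : TopologicalSpace (MaxIdeal A) :=
  TopologicalSpace.generateFrom {U | ∃ a : A, U = {M | a ∉ M.1}}

/-! ### Elementary facts about ideals -/

theorem IsIdeal.of_le {I : Submodule ℝ A} (hI : IsIdeal I) {x y : A} (hy : y ∈ I) (h0 : 0 ≤ x)
    (h : x ≤ y) : x ∈ I :=
  hI x y hy (by rwa [abs_of_nonneg h0, abs_of_nonneg (h0.trans h)])

theorem IsIdeal.abs_mem {I : Submodule ℝ A} (hI : IsIdeal I) {x : A} (hx : x ∈ I) : |x| ∈ I :=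
  hI _ x hx (by rw [abs_abs])

theorem IsIdeal.of_abs_le {I : Submodule ℝ A} (hI : IsIdeal I) {x y : A} (hy : y ∈ I)
    (h : |x| ≤ y) : x ∈ I :=
  hI x y hy (h.trans (le_abs_self y))

/-- The ideal generated by `S`. -/
def idealSpan (S : Set A) : Submodule ℝ A where
  carrier := {y | ∃ t : Finset A, (t : Set A) ⊆ S ∧ ∃ n : ℕ, |y| ≤ n • ∑ a ∈ t, |a|}
  zero_mem' := ⟨∅, by simp, 0, by simp⟩
  add_mem' := by
    classical
    rintro x y ⟨t, ht, n, hn⟩ ⟨t', ht', n', hn'⟩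
    refine ⟨t ∪ t', by simp [ht, ht'], n + n', ?_⟩
    have h1 : ∑ a ∈ t, |a| ≤ ∑ a ∈ t ∪ t', |a| :=
      Finset.sum_le_sum_of_subset_of_nonneg Finset.subset_union_left
        (fun a _ _ => abs_nonneg a)
    have h2 : ∑ a ∈ t', |a| ≤ ∑ a ∈ t ∪ t', |a| :=
      Finset.sum_le_sum_of_subset_of_nonneg Finset.subset_union_right
        (fun a _ _ => abs_nonneg a)
    rw [add_smul]
    exact (abs_add_le x y).trans (add_le_add (hn.trans (nsmul_le_nsmul_right h1 n))
      (hn'.trans (nsmul_le_nsmul_right h2 n')))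
  smul_mem' := by
    rintro c x ⟨t, ht, n, hn⟩
    obtain ⟨k, hk⟩ := exists_nat_ge |c|
    refine ⟨t, ht, k * n, ?_⟩
    have key : ∀ z : A, 0 ≤ z → c • z ≤ (k : ℝ) • z := fun z hz => by
      have : 0 ≤ ((k : ℝ) - c) • z := smul_nonneg (by linarith [le_abs_self c]) hz
      rwa [sub_smul, sub_nonneg] at this
    have key' : ∀ z : A, 0 ≤ z → (-c) • z ≤ (k : ℝ) • z := fun z hz => by
      have : 0 ≤ ((k : ℝ) - -c) • z := smul_nonneg (by linarith [neg_abs_le c]) hz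
      rwa [sub_smul, sub_nonneg] at this
    have h3 : |c • x| ≤ (k : ℝ) • |x| := by
      rcases le_total 0 c with hc | hc
      · refine abs_le'.2 ⟨?_, ?_⟩
        · exact (smul_le_smul_of_nonneg_left (le_abs_self x) hc).trans (key _ (abs_nonneg x))
        · rw [← smul_neg]
          exact (smul_le_smul_of_nonneg_left (neg_le_abs x) hc).trans (key _ (abs_nonneg x))
      · have hc' : 0 ≤ -c := by linarith
        refine abs_le'.2 ⟨?_, ?_⟩
        · rw [← neg_smul_neg]
          exact (smul_le_smul_of_nonneg_left (neg_le_abs x) hc').trans (key' _ (abs_nonneg x))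
        · rw [← neg_smul]
          exact (smul_le_smul_of_nonneg_left (le_abs_self x) hc').trans (key' _ (abs_nonneg x))
    rw [mul_smul, ← Nat.cast_smul_eq_nsmul ℝ k]
    exact h3.trans (smul_le_smul_of_nonneg_left hn (Nat.cast_nonneg k))

theorem isIdeal_idealSpan (S : Set A) : IsIdeal (idealSpan S) := by
  rintro x y ⟨t, ht, n, hn⟩ hxy
  exact ⟨t, ht, n, hxy.trans hn⟩

theorem subset_idealSpan (S : Set A) {a : A} (ha : a ∈ S) : a ∈ idealSpan S :=
  ⟨{a}, by simpa using ha, 1, by simp⟩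

theorem nsmul_abs_mem {I : Submodule ℝ A} (hI : IsIdeal I) {t : Finset A}
    (ht : ∀ a ∈ t, a ∈ I) (n : ℕ) : n • ∑ a ∈ t, |a| ∈ I :=
  I.smul_of_tower_mem n (I.sum_mem fun a ha => hI.abs_mem (ht a ha))

/-- An ideal that omits the unit lies in one that is maximal with this property. -/
theorem exists_isUnitMaximal {I : Submodule ℝ A} (hI : IsIdeal I) (hu : A.unit ∉ I) :
    ∃ M : MaxIdeal A, I ≤ M.1 := by
  obtain ⟨M, hIM, hM⟩ := zorn_le_nonempty₀ {J : Submodule ℝ A | IsIdeal J ∧ A.unit ∉ J}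
    (by
      intro c hc hchain y hy
      have hne : c.Nonempty := ⟨y, hy⟩
      have hmem : ∀ x, x ∈ sSup c ↔ ∃ J ∈ c, x ∈ J := fun x =>
        Submodule.mem_sSup_of_directed hne hchain.directedOn
      refine ⟨sSup c, ⟨?_, ?_⟩, fun z hz => le_sSup hz⟩
      · intro x z hz hxz
        obtain ⟨J, hJ, hzJ⟩ := (hmem z).1 hz
        exact (hmem x).2 ⟨J, hJ, (hc hJ).1 x z hzJ hxz⟩
      · intro h
        obtain ⟨J, hJ, huJ⟩ := (hmem _).1 h
        exact (hc hJ).2 huJ) I ⟨hI, hu⟩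
  refine ⟨⟨M, hM.prop.1, hM.prop.2, fun J hJ hJu hMJ => ?_⟩, hIM⟩
  exact le_antisymm (hM.le_of_ge ⟨hJ, hJu⟩ hMJ) hMJ

theorem IsUnitMaximal.exists_unit_le {M : Submodule ℝ A} (hM : IsUnitMaximal M) {x : A}
    (hx : x ∉ M) : ∃ m ∈ M, 0 ≤ m ∧ ∃ n : ℕ, A.unit ≤ m + n • |x| := by
  classical
  by_contra hcon
  have hu : A.unit ∉ idealSpan (insert x (M : Set A)) := by
    rintro ⟨t, ht, n, hn⟩
    refine hcon ⟨n • ∑ a ∈ t.erase x, |a|, nsmul_abs_mem hM.isIdeal (fun a ha => ?_) n,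
      nsmul_nonneg (Finset.sum_nonneg fun a _ => abs_nonneg a) n, n, ?_⟩
    · have h1 := ht (Finset.mem_of_mem_erase ha)
      exact h1.resolve_left (Finset.ne_of_mem_erase ha)
    · rw [abs_of_nonneg A.unit_nonneg] at hn
      rw [← smul_add]
      refine hn.trans (nsmul_le_nsmul_right ?_ n)
      by_cases hxt : x ∈ t
      · exact (Finset.sum_erase_add t _ hxt).ge
      · rw [Finset.erase_eq_of_notMem hxt]
        exact le_add_of_nonneg_right (abs_nonneg x)
  have h := hM.maximal _ (isIdeal_idealSpan _) hu
    (fun m hm => subset_idealSpan _ (Set.mem_insert_of_mem _ hm))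
  exact hx (h ▸ subset_idealSpan _ (Set.mem_insert _ _))

theorem IsUnitMaximal.prime {M : Submodule ℝ A} (hM : IsUnitMaximal M) {x y : A}
    (h : |x| ⊓ |y| = 0) : x ∈ M ∨ y ∈ M := by
  by_contra hcon
  obtain ⟨hx, hy⟩ := not_or.1 hcon
  obtain ⟨m, hm, hm0, n, hn⟩ := hM.exists_unit_le hx
  obtain ⟨m', hm', hm0', n', hn'⟩ := hM.exists_unit_le hy
  have h1 : A.unit ≤ (m + m') + (n + n') • |x| := by
    refine hn.trans (add_le_add (le_add_of_nonneg_right hm0') ?_)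
    exact nsmul_le_nsmul_left (abs_nonneg x) (Nat.le_add_right n n')
  have h2 : A.unit ≤ (m + m') + (n + n') • |y| := by
    refine hn'.trans (add_le_add (le_add_of_nonneg_left hm0) ?_)
    exact nsmul_le_nsmul_left (abs_nonneg y) (Nat.le_add_left n' n)
  have h3 : ((n + n') • |x|) ⊓ ((n + n') • |y|) = 0 := by
    have hk : ∀ k : ℕ, ∀ a b : A, 0 ≤ a → 0 ≤ b → a ⊓ b = 0 → (k • a) ⊓ b = 0 := by
      intro k a b ha hb hab
      induction k with
      | zero => simpa using hb
      | succ k ih =>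
        refine le_antisymm ?_ (le_inf (nsmul_nonneg ha _) hb)
        have hz0 : 0 ≤ ((k + 1) • a) ⊓ b := le_inf (nsmul_nonneg ha _) hb
        set z := ((k + 1) • a) ⊓ b with hz
        have e1 : z ≤ k • a + a := by rw [← succ_nsmul]; exact inf_le_left
        have e2 : z ≤ b := inf_le_right
        have e3 : z - a ≤ k • a ⊓ b :=
          le_inf (sub_le_iff_le_add.2 e1) ((sub_le_self z ha).trans e2)
        rw [ih, sub_nonpos] at e3
        exact (le_inf e3 e2).trans hab.le
    have := hk (n + n') _ _ (abs_nonneg x) (abs_nonneg y) h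
    rw [inf_comm] at this ⊢
    exact hk (n + n') _ _ (abs_nonneg y) (nsmul_nonneg (abs_nonneg x) _) this
  have h4 : A.unit ≤ m + m' := by
    have := le_inf (sub_le_iff_le_add'.2 h1) (sub_le_iff_le_add'.2 h2)
    rw [h3] at this
    exact sub_nonpos.1 this
  exact hM.unit_notMem (hM.isIdeal.of_le (M.add_mem hm hm') A.unit_nonneg h4)

theorem IsUnitMaximal.posPart_or_negPart {M : Submodule ℝ A} (hM : IsUnitMaximal M) (x : A) :
    x⁺ ∈ M ∨ x⁻ ∈ M := by
  refine hM.prime ?_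
  rw [abs_of_nonneg (posPart_nonneg x), abs_of_nonneg (negPart_nonneg x)]
  exact posPart_inf_negPart_eq_zero x

/-- Modulo a unit-maximal ideal every element is a real multiple of the unit. -/
theorem IsUnitMaximal.exists_value {M : Submodule ℝ A} (hM : IsUnitMaximal M) (a : A) :
    ∃ r : ℝ, a - r • A.unit ∈ M := by
  have hI := hM.isIdeal
  have hscale : ∀ ε : ℝ, 0 < ε → ∀ w ∈ M, ¬ (ε • A.unit ≤ w) := by
    intro ε hε w hw hle
    refine hM.unit_notMem ?_
    have : ε • A.unit ∈ M := hI.of_le hw (smul_nonneg hε.le A.unit_nonneg) hle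
    simpa [smul_smul, hε.ne'] using M.smul_mem ε⁻¹ this
  obtain ⟨n, hn⟩ := A.strong a
  rw [← Nat.cast_smul_eq_nsmul ℝ] at hn
  obtain ⟨hn1, hn2⟩ := abs_le'.1 hn
  set S : Set ℝ := {s | (s • A.unit - a)⁺ ∈ M} with hS
  have hne : S.Nonempty := by
    refine ⟨-n, ?_⟩
    have h0 : (-(n : ℝ)) • A.unit - a ≤ 0 := by
      rw [neg_smul, sub_nonpos]; exact neg_le.1 hn2
    change ((-(n : ℝ)) • A.unit - a)⁺ ∈ M
    rw [posPart_eq_zero.2 h0]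
    exact M.zero_mem
  have hbdd : BddAbove S := by
    refine ⟨n, fun s hs => ?_⟩
    by_contra hlt
    refine hscale (s - n) (by linarith) _ hs ?_
    refine le_trans ?_ (le_posPart _)
    rw [sub_smul]
    exact sub_le_sub_left hn1 _
  refine ⟨sSup S, ?_⟩
  set r := sSup S with hr
  by_contra hx
  set x := a - r • A.unit with hxdef
  have hparts : x = x⁺ - x⁻ := (posPart_sub_negPart x).symm
  have hnot : ¬ (x⁺ ∈ M ∧ x⁻ ∈ M) := fun h => hx (hparts ▸ M.sub_mem h.1 h.2)
  rcases hM.posPart_or_negPart x with hp | hq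
  · -- the negative part is not in the ideal
    have hq : x⁻ ∉ M := fun h => hnot ⟨hp, h⟩
    obtain ⟨m, hm, hm0, k, hk⟩ := hM.exists_unit_le hq
    rw [abs_of_nonneg (negPart_nonneg x), ← Nat.cast_smul_eq_nsmul ℝ] at hk
    have hkpos : (0 : ℝ) < k + 1 := by positivity
    have hk' : A.unit ≤ m + ((k : ℝ) + 1) • x⁻ := by
      rw [add_smul, one_smul, ← add_assoc]
      exact le_add_of_le_of_nonneg hk (negPart_nonneg x)
    obtain ⟨s, hs, hsr⟩ := exists_lt_of_lt_csSup hne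
      (show r - 1 / (2 * ((k : ℝ) + 1)) < sSup S by
        have : 0 < 1 / (2 * ((k : ℝ) + 1)) := by positivity
        linarith)
    have hpos : 0 < 1 - ((k : ℝ) + 1) * (r - s) := by
      have h1 : r - s < 1 / (2 * ((k : ℝ) + 1)) := by linarith
      have h2 : ((k : ℝ) + 1) * (r - s) < ((k : ℝ) + 1) * (1 / (2 * ((k : ℝ) + 1))) :=
        mul_lt_mul_of_pos_left h1 hkpos
      have h3 : ((k : ℝ) + 1) * (1 / (2 * ((k : ℝ) + 1))) = 1 / 2 := by field_simp
      linarith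
    refine hscale _ hpos (m + ((k : ℝ) + 1) • ((s • A.unit - a)⁺ + x⁺))
      (M.add_mem hm (M.smul_mem _ (M.add_mem hs hp))) ?_
    have hle : x⁻ - (r - s) • A.unit ≤ (s • A.unit - a)⁺ + x⁺ := by
      have h4 : x⁻ - (r - s) • A.unit = (s • A.unit - a) + x⁺ := by
        have : x⁻ = x⁺ - x := by
          nth_rewrite 3 [hparts]; abel
        rw [this, hxdef, sub_smul]; abel
      rw [h4]
      exact add_le_add_left (le_posPart _) _
    have h5 := smul_le_smul_of_nonneg_left hle hkpos.le
    rw [smul_sub, smul_smul] at h5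
    rw [sub_smul, one_smul]
    calc A.unit - (((k : ℝ) + 1) * (r - s)) • A.unit
        ≤ (m + ((k : ℝ) + 1) • x⁻) - (((k : ℝ) + 1) * (r - s)) • A.unit :=
          sub_le_sub_right hk' _
      _ = m + (((k : ℝ) + 1) • x⁻ - (((k : ℝ) + 1) * (r - s)) • A.unit) := by abel
      _ ≤ _ := add_le_add_right h5 _
  · -- the positive part is not in the ideal
    have hp : x⁺ ∉ M := fun h => hnot ⟨h, hq⟩
    obtain ⟨m, hm, hm0, k, hk⟩ := hM.exists_unit_le hp
    rw [abs_of_nonneg (posPart_nonneg x), ← Nat.cast_smul_eq_nsmul ℝ] at hk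
    have hkpos : (0 : ℝ) < k + 1 := by positivity
    have hk' : A.unit ≤ m + ((k : ℝ) + 1) • x⁺ := by
      rw [add_smul, one_smul, ← add_assoc]
      exact le_add_of_le_of_nonneg hk (posPart_nonneg x)
    have hmem : r + ((k : ℝ) + 1)⁻¹ ∈ S := by
      refine hI.of_le (y := ((k : ℝ) + 1)⁻¹ • m + x⁻)
        (M.add_mem (M.smul_mem _ hm) hq) (posPart_nonneg _) ?_
      refine sup_le ?_ (add_nonneg (smul_nonneg (by positivity) hm0) (negPart_nonneg x))
      have h5 := smul_le_smul_of_nonneg_left hk' (inv_nonneg.2 hkpos.le)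
      rw [smul_add, smul_smul, inv_mul_cancel₀ hkpos.ne', one_smul] at h5
      calc (r + ((k : ℝ) + 1)⁻¹) • A.unit - a = ((k : ℝ) + 1)⁻¹ • A.unit - x := by
            rw [hxdef, add_smul]; abel
        _ ≤ (((k : ℝ) + 1)⁻¹ • m + x⁺) - x := sub_le_sub_right h5 _
        _ = ((k : ℝ) + 1)⁻¹ • m + x⁻ := by
            nth_rewrite 2 [hparts]; abel
    have := le_csSup hbdd hmem
    have : 0 < ((k : ℝ) + 1)⁻¹ := by positivity
    linarith

/-! ### The Yosida representation -/

/-- `ν_A(a)(M)`, the real number `r` with `a + M = r (u + M)`. -/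
def value (a : A) (M : MaxIdeal A) : ℝ := (M.2.exists_value a).choose

theorem value_spec (a : A) (M : MaxIdeal A) : a - value a M • A.unit ∈ M.1 :=
  (M.2.exists_value a).choose_spec

theorem value_eq {a : A} {M : MaxIdeal A} {r : ℝ} (h : a - r • A.unit ∈ M.1) :
    value a M = r := by
  by_contra hne
  have h1 := M.1.sub_mem h (value_spec a M)
  have h2 : (a - r • A.unit) - (a - value a M • A.unit) = (value a M - r) • A.unit := by
    rw [sub_smul]; abel
  rw [h2] at h1
  refine M.2.unit_notMem ?_
  simpa [smul_smul, sub_ne_zero.2 hne] using M.1.smul_mem (value a M - r)⁻¹ h1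

theorem value_add (a b : A) (M : MaxIdeal A) : value (a + b) M = value a M + value b M := by
  refine value_eq ?_
  have := M.1.add_mem (value_spec a M) (value_spec b M)
  convert this using 1
  rw [add_smul]; abel

theorem value_smul (c : ℝ) (a : A) (M : MaxIdeal A) : value (c • a) M = c * value a M := by
  refine value_eq ?_
  have := M.1.smul_mem c (value_spec a M)
  rwa [smul_sub, smul_smul] at this

theorem value_unit (M : MaxIdeal A) : value A.unit M = 1 :=
  value_eq (by simp)

theorem value_neg (a : A) (M : MaxIdeal A) : value (-a) M = -value a M := by
  simpa using value_smul (-1) a M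

theorem value_sup (a b : A) (M : MaxIdeal A) : value (a ⊔ b) M = value a M ⊔ value b M := by
  refine value_eq ?_
  have hsup : (value a M ⊔ value b M) • A.unit = value a M • A.unit ⊔ value b M • A.unit := by
    have hmono : Monotone fun t : ℝ => t • A.unit := fun s t hst => by
      have : 0 ≤ (t - s) • A.unit := smul_nonneg (sub_nonneg.2 hst) A.unit_nonneg
      rwa [sub_smul, sub_nonneg] at this
    exact hmono.map_sup _ _
  rw [hsup]
  set p := value a M • A.unit
  set q := value b M • A.unit
  have h1 : (a ⊔ b) - (p ⊔ b) ∈ M.1 :=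
    M.2.isIdeal _ _ (value_spec a M) (abs_sup_sub_sup_le_abs a p b)
  have h2 : (p ⊔ b) - (p ⊔ q) ∈ M.1 := by
    rw [sup_comm p b, sup_comm p q]
    exact M.2.isIdeal _ _ (value_spec b M) (abs_sup_sub_sup_le_abs b q p)
  simpa using M.1.add_mem h1 h2

theorem value_inf (a b : A) (M : MaxIdeal A) : value (a ⊓ b) M = value a M ⊓ value b M := by
  have : a ⊓ b = -(-a ⊔ -b) := by rw [neg_sup, neg_neg, neg_neg]
  rw [this, value_neg, value_sup, value_neg, value_neg, neg_sup, neg_neg, neg_neg]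

theorem value_eq_zero_iff (a : A) (M : MaxIdeal A) : value a M = 0 ↔ a ∈ M.1 :=
  ⟨fun h => by simpa [h] using value_spec a M, fun h => value_eq (by simpa using h)⟩

theorem continuous_value (a : A) : Continuous (value a) := by
  have hopen : ∀ (b : A) (r : ℝ), IsOpen {M : MaxIdeal A | r < value b M} := by
    intro b r
    have : {M : MaxIdeal A | r < value b M} = {M | (b - r • A.unit) ⊔ 0 ∉ M.1} := by
      ext M
      have h0 : value (0 : A) M = 0 := (value_eq_zero_iff _ _).2 M.1.zero_mem
      have h1 : value (b - r • A.unit) M = value b M - r := by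
        rw [sub_eq_add_neg, value_add, value_neg, value_smul, value_unit]; ring
      rw [Set.mem_ofPred_eq, Set.mem_ofPred_eq, ← value_eq_zero_iff, value_sup, h0, h1,
        sup_eq_right, sub_nonpos, not_le]
    rw [this]
    exact TopologicalSpace.isOpen_generateFrom_of_mem ⟨_, rfl⟩
  refine OrderTopology.continuous_iff.2 fun r => ⟨hopen a r, ?_⟩
  have := hopen (-a) (-r)
  simpa [value_neg, Set.preimage, Set.Iio] using this

instance : T2Space (MaxIdeal A) := by
  refine ⟨fun M N hMN => ?_⟩
  have : ∃ a, a ∈ M.1 ∧ a ∉ N.1 := by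
    by_contra hcon
    push Not at hcon
    exact hMN (Subtype.ext (M.2.maximal _ N.2.isIdeal N.2.unit_notMem hcon).symm)
  obtain ⟨a, haM, haN⟩ := this
  refine separated_by_continuous (continuous_value a) ?_
  rw [(value_eq_zero_iff a M).2 haM]
  exact fun h => haN ((value_eq_zero_iff a N).1 h.symm)

instance : CompactSpace (MaxIdeal A) := by
  classical
  refine compactSpace_generateFrom rfl fun P hP hcov => ?_
  set T : Set A := {a | {M : MaxIdeal A | a ∉ M.1} ∈ P} with hT
  have hu : A.unit ∈ idealSpan T := by
    by_contra hu
    obtain ⟨M, hM⟩ := exists_isUnitMaximal (isIdeal_idealSpan T) hu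
    obtain ⟨U, hU, hMU⟩ := (hcov ▸ Set.mem_univ M : M ∈ ⋃₀ P)
    obtain ⟨a, rfl⟩ := hP hU
    exact hMU (hM (subset_idealSpan T hU))
  obtain ⟨t, ht, n, hn⟩ := hu
  refine ⟨(fun a : A => {M : MaxIdeal A | a ∉ M.1}) '' t, ?_, t.finite_toSet.image _, ?_⟩
  · rintro _ ⟨a, ha, rfl⟩
    exact ht ha
  · refine Set.eq_univ_of_forall fun M => ?_
    by_contra hM
    have hall : ∀ a ∈ t, a ∈ M.1 := by
      intro a ha
      by_contra haM
      exact hM ⟨_, ⟨a, ha, rfl⟩, haM⟩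
    exact M.2.unit_notMem (M.2.isIdeal.of_abs_le (nsmul_abs_mem M.2.isIdeal hall n) hn)

variable (A) in
/-- The Yosida space `YA`. -/
def yosidaSpace : CompHaus.{u} := CompHaus.of (MaxIdeal A)

/-- `C(X)`, with the constant function `1` as its unit. -/
def ofC (X : CompHaus.{u}) : Wstar.{u} where
  carrier := C(X, ℝ)
  instPosSMulMono := ⟨fun r hr f g hfg =>
    ContinuousMap.le_def.2 fun x => mul_le_mul_of_nonneg_left (ContinuousMap.le_def.1 hfg x) hr⟩
  archimedean f g hf h := by
    ext x
    by_contra hne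
    have hpos : 0 < f x := lt_of_le_of_ne (hf x) (Ne.symm hne)
    obtain ⟨n, hn⟩ := exists_nat_gt (g x / f x)
    have h1 : (n : ℝ) * f x ≤ g x := by simpa using h n x
    rw [div_lt_iff₀ hpos] at hn
    linarith
  unit := 1
  unit_nonneg := fun _ => zero_le_one
  strong f := by
    obtain ⟨n, hn⟩ := exists_nat_ge ‖f‖
    refine ⟨n, fun x => ?_⟩
    have h1 : |f x| ≤ ‖f‖ := f.norm_coe_le_norm x
    simpa [ContinuousMap.abs_apply] using h1.trans hn

variable (A) in
/-- The Yosida representation `ν_A : A → C(YA)`. -/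
def yosidaHom : Hom A (ofC (yosidaSpace A)) where
  toFun a := (⟨value a, continuous_value a⟩ : C(MaxIdeal A, ℝ))
  map_add' a b := ContinuousMap.ext (value_add a b)
  map_smul' c a := ContinuousMap.ext (value_smul c a)
  map_sup a b := ContinuousMap.ext (value_sup a b)
  map_inf a b := ContinuousMap.ext (value_inf a b)
  map_unit := ContinuousMap.ext value_unit

/-- The morphism `C(X) → C(Y)`, `f ↦ f ∘ τ`, induced by a continuous `τ : Y → X`. -/
def pullback {X Y : CompHaus.{u}} (τ : C(Y, X)) : Hom (ofC X) (ofC Y) where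
  toFun (f : C(X, ℝ)) := f.comp τ
  map_add' _ _ := rfl
  map_smul' _ _ := rfl
  map_sup _ _ := rfl
  map_inf _ _ := rfl
  map_unit := rfl

end Wstar

/-- `μ(c)A = C(cYA)`, with `μ(c)_A : A → C(YA) → C(cYA)` the Yosida representation followed by
composition with `c_{YA} : cYA → YA`. -/
def mu (c : CoverAssignment.{u}) : HullAssignment.{u} := fun A =>
  { obj := Wstar.ofC (c A.yosidaSpace).space
    map := (Wstar.pullback (c A.yosidaSpace).map).comp A.yosidaHom }

/-- The uniform completion operator: `uA = C(YA)` and `u_A = ν_A`. -/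
def uniformCompletion : HullAssignment.{u} := fun A =>
  { obj := Wstar.ofC A.yosidaSpace
    map := A.yosidaHom }

/-! ## The ring reflection and the projectable hull -/

namespace Wstar

/-- `A` carries the structure of an `f`-ring (`f`-algebra) whose identity is the unit. -/
def IsFRing (A : Wstar.{u}) : Prop :=
  ∃ m : A →ₗ[ℝ] A →ₗ[ℝ] A,
    (∀ x y z, m (m x y) z = m x (m y z)) ∧
    (∀ x, m A.unit x = x) ∧ (∀ x, m x A.unit = x) ∧
    (∀ x y, 0 ≤ x → 0 ≤ y → 0 ≤ m x y) ∧
    (∀ x y z, x ⊓ y = 0 → 0 ≤ z → m z x ⊓ y = 0 ∧ m x z ⊓ y = 0)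

/-- The polar `S^⊥` of a set. -/
def polar {A : Wstar.{u}} (S : Set A) : Set A := {x | ∀ s ∈ S, |x| ⊓ |s| = 0}

/-- `A` is projectable: `A = a^⊥⊥ + a^⊥` for every `a ∈ A`. -/
def IsProjectable (A : Wstar.{u}) : Prop :=
  ∀ a x : A, ∃ y ∈ polar (polar {a}), ∃ z ∈ polar {a}, x = y + z

end Wstar

/-- `r` is the ring reflection: every `rA` is an `f`-ring with the unit as its identity, and every
morphism from `A` to such an `f`-ring extends uniquely over `r_A : A → rA`. (Unit-preserving vector
lattice homomorphisms between such archimedean `f`-rings preserve multiplication.) -/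
structure IsRingReflection (r : HullAssignment.{u}) : Prop where
  isFRing : ∀ A, (r A).obj.IsFRing
  existsUnique : ∀ (A R : Wstar.{u}), R.IsFRing → ∀ f : Wstar.Hom A R,
    ∃! g : Wstar.Hom (r A).obj R, f = g.comp (r A).map

/-- `p` is the projectable hull: `pA` is the minimum projectable essential extension of `A`. -/
structure IsProjectableHull (p : HullAssignment.{u}) : Prop where
  isEssential : ∀ A, (p A).map.IsEssential
  isProjectable : ∀ A, (p A).obj.IsProjectable
  minimum : ∀ A (P : Wstar.Under A), P.map.IsEssential → P.obj.IsProjectable → p A ≤ P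

end

noncomputable section

/-! ## Irreducible maps of compact Hausdorff spaces -/

namespace OverSpace

variable {X Y Z : CompHaus.{u}}

/-! The proof rests on Yosida duality. A point of `YA` is the same as a real character of `A`, so a
morphism `A → C(X)` is the same as a continuous map `X → YA` (`value_dual`, `pullback_dual`). The
Archimedean property makes `ν_A` injective (`value_injective`). The morphism is injective exactly
when its dual map is onto, and essential exactly when its dual map is irreducible
(`isEssential_iff`, `isEssential_iff_dual`). Essential extensions of `A` thus become covers of `YA`,
and `X` is recovered from `C(X)` as its Yosida space (`pointMap_bijective`).

Under this dictionary `μ(c)_A` is dual to `c_{YA}`, and `μ(c)` fixes `A` only if `ν_A` is onto and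
`YA` is fixed by `c`. Minimality of `c` therefore gives minimality of `μ(c)`. Injectivity of `μ`
follows by evaluating at the objects `C(X)`.

If `μ(c) ≤ h`, every object fixed by `h` is uniformly complete (`yosidaHom_bijective_of_mu_le`). The
real sequences with finite range form a projectable `f`-ring, hence are fixed by `r` and by `p`, but
they are not uniformly complete. So neither operator lies in the range of `μ`.

Both operators are constructed by generation inside some `C(X)`. For `r`, close `A` under products
in `C(YA)`; multiplication in any target `f`-ring is pointwise on its Yosida space (`value_mul`), so
morphisms extend. For `p`, close `A` under band projections in `C(E)`, where `E` is the Gleason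
cover of `YA`; projectivity of `E` embeds every projectable essential extension in `C(E)`, and
irreducibility makes its range closed under these projections (`exists_eq_projC`). -/

theorem isCover_mk {P : OverSpace X} (hs : Function.Surjective P.map)
    (hi : ∀ F : Set P.space, IsClosed F → P.map '' F = Set.univ → F = Set.univ) : P.IsCover :=
  have : T1Space X := T2Space.t1Space
  ⟨hs, P.map.continuous.isClosedMap,
    fun _ => (isClosed_singleton.preimage P.map.continuous).isCompact, hi⟩

theorem isCover_of_bijective {f : C(Y, X)} (hf : Function.Bijective f) :
    (OverSpace.mk Y f).IsCover := by
  refine isCover_mk hf.2 fun F _ hF => ?_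
  change f '' F = Set.univ at hF
  rw [← Set.preimage_image_eq F hf.1, hF, Set.preimage_univ]

theorem IsCover.comp {f : C(Y, X)} {g : C(Z, Y)} (hf : (OverSpace.mk Y f).IsCover)
    (hg : (OverSpace.mk Z g).IsCover) : (OverSpace.mk Z (f.comp g)).IsCover := by
  refine isCover_mk (hf.surjective.comp hg.surjective) fun F hF h => ?_
  refine hg.irreducible F hF (hf.irreducible _ (hg.isClosedMap F hF) ?_)
  rw [← h]
  exact Set.image_image _ _ _

/-- If `f ∘ g` is irreducible and `g` is surjective, then `f` is irreducible. -/
theorem IsCover.of_comp {f : C(Y, X)} {g : C(Z, Y)} (hg : Function.Surjective g)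
    (h : (OverSpace.mk Z (f.comp g)).IsCover) : (OverSpace.mk Y f).IsCover := by
  refine isCover_mk (fun x => ?_) fun F hF hFu => ?_
  · obtain ⟨z, hz⟩ := h.surjective x
    exact ⟨g z, hz⟩
  · have h1 : g ⁻¹' F = Set.univ := by
      refine h.irreducible _ (hF.preimage g.continuous) ?_
      change (fun z => f (g z)) '' (g ⁻¹' F) = Set.univ
      rw [← Set.image_image f g, Set.image_preimage_eq F hg]
      exact hFu
    rw [← Set.image_preimage_eq F hg, h1, Set.image_univ, hg.range_eq]

/-- If `f` is irreducible and `f ∘ g` is surjective, then `g` is surjective. -/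
theorem IsCover.surjective_of_comp {f : C(Y, X)} {g : C(Z, Y)} (hf : (OverSpace.mk Y f).IsCover)
    (h : Function.Surjective (f.comp g)) : Function.Surjective g := by
  rw [← Set.range_eq_univ]
  refine hf.irreducible _ (isCompact_range g.continuous).isClosed ?_
  rw [← Set.range_comp]
  exact h.range_eq

/-- Every nonempty open set of a cover contains the preimage of a nonempty open set. -/
theorem IsCover.exists_open {f : C(Y, X)} (hf : (OverSpace.mk Y f).IsCover) {U : Set Y}
    (hU : IsOpen U) (hne : U.Nonempty) : ∃ W : Set X, IsOpen W ∧ W.Nonempty ∧ f ⁻¹' W ⊆ U := by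
  refine ⟨(f '' Uᶜ)ᶜ, (hf.isClosedMap _ hU.isClosed_compl).isOpen_compl, ?_, ?_⟩
  · rw [Set.nonempty_compl]
    intro h
    have := hf.irreducible _ hU.isClosed_compl h
    rw [Set.compl_univ_iff] at this
    exact hne.ne_empty this
  · intro y hy
    by_contra hyU
    exact hy ⟨y, hyU, rfl⟩

/-- Take a closed subset `E` of the Stone–Čech compactification of `D` that is minimal among those
mapping onto `X`. Minimality is irreducibility, and it also forces a lift `ρ` of the map to `X`
through `E` to be the identity on `E`. So `E` is a retract of a projective space. The discrete space
is a separate type so that its topology does not clash with that of `X`. -/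
theorem exists_projective_cover_of_discrete (X : CompHaus.{u}) {D : Type u} [TopologicalSpace D]
    [DiscreteTopology D] {d : D → X} (hd : Function.Surjective d) :
    ∃ (E : CompHaus.{u}) (p : C(E, X)), (OverSpace.mk E p).IsCover ∧
      CompactT2.Projective E := by
  have : T1Space X := T2Space.t1Space
  have hproj : CompactT2.Projective (StoneCech D) := StoneCech.projective
  have hid : Continuous d := continuous_of_discreteTopology
  let q : StoneCech D → X := stoneCechExtend hid
  have hq : Continuous q := continuous_stoneCechExtend hid
  have hqs : Function.Surjective q := fun x => by
    obtain ⟨z, rfl⟩ := hd x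
    exact ⟨stoneCechUnit z, congrFun (stoneCechExtend_extends hid) z⟩
  obtain ⟨E, hE, hEu, hEz⟩ := exists_compact_surjective_zorn_subset hq hqs
  let p : C(CompHaus.of E, X) := ⟨fun e => q e.1, hq.comp continuous_subtype_val⟩
  have hps : Function.Surjective p := fun x => by
    obtain ⟨e, he, rfl⟩ := (hEu ▸ Set.mem_univ x : x ∈ q '' E)
    exact ⟨⟨e, he⟩, rfl⟩
  have hp : (OverSpace.mk (CompHaus.of E) p).IsCover := by
    refine isCover_mk hps fun F hF h => ?_
    by_contra hne
    exact hEz F hne hF h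
  refine ⟨CompHaus.of E, p, hp, ?_⟩
  obtain ⟨ρ, hρ, hρq⟩ := hproj hq p.continuous hps
  let s : E → E := fun e => ρ e.1
  have hs : Continuous s := hρ.comp continuous_subtype_val
  have hps : ∀ e, p (s e) = p e := fun e => congrFun hρq e.1
  -- If `s` moves `e`, separate `s e` from `e` by `V` and `U`. Irreducibility puts a whole fibre of
  -- `p` inside `U ∩ s ⁻¹' V`. This fibre contains some `e'` and also `s e'`, so `s e'` lies in both
  -- `V` and `U`.
  have hsid : ∀ e, s e = e := by
    intro e
    by_contra hne
    obtain ⟨V, U, hV, hU, heV, heU, hVU⟩ := t2_separation hne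
    obtain ⟨W, -, ⟨w, hw⟩, hWU⟩ := hp.exists_open (U := (U ∩ s ⁻¹' V : Set E))
      (hU.inter (hV.preimage hs)) ⟨e, heU, heV⟩
    obtain ⟨e', rfl⟩ := hp.surjective w
    have h1 : e' ∈ U ∩ s ⁻¹' V := hWU hw
    have h2 : s e' ∈ U ∩ s ⁻¹' V := hWU (by
      change p (s e') ∈ W
      rw [hps]; exact hw)
    exact Set.disjoint_left.1 hVU h1.2 h2.1
  -- To lift `f` through `g`, lift `f ∘ ρ` from the projective space and restrict the result to `E`.
  intro Y Z _ _ _ _ _ _ f g hf hg hgs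
  obtain ⟨h, hh, hgh⟩ := hproj (hf.comp hρ) hg hgs
  refine ⟨fun e => h e.1, hh.comp continuous_subtype_val, funext fun e => ?_⟩
  have : g (h e.1) = f (ρ e.1) := congrFun hgh e.1
  exact this.trans (congrArg f (hsid e))

/-- The Gleason cover: every compact Hausdorff space has a projective cover. -/
theorem exists_projective_cover (X : CompHaus.{u}) :
    ∃ (E : CompHaus.{u}) (p : C(E, X)), (OverSpace.mk E p).IsCover ∧
      CompactT2.Projective E :=
  @exists_projective_cover_of_discrete X X ⊥ (discreteTopology_bot X) id Function.surjective_id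

end OverSpace

/-! ## Spaces fixed by a covering operator -/

namespace IsCoveringOperator

variable {c d : CoverAssignment.{u}}

/-- Minimality factors the injective `f` as `c_X ∘ g`, and `g` is onto because `c_X` is irreducible.
Hence `c_X` is injective. -/
theorem fix_of_bijective (hc : IsCoveringOperator c) {X Y : CompHaus.{u}} {f : C(Y, X)}
    (hf : Function.Bijective f) (hY : c.Fix Y) : c.Fix X := by
  obtain ⟨g, hg⟩ := hc.minimum X ⟨Y, f⟩ (OverSpace.isCover_of_bijective hf) hY
  change f = (c X).map.comp g at hg
  have hgs : Function.Surjective g := (hc.isCover X).surjective_of_comp (by rw [← hg]; exact hf.2)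
  refine isHomeomorph_iff_continuous_bijective.2 ⟨(c X).map.continuous, ?_,
    (hc.isCover X).surjective⟩
  intro a b hab
  obtain ⟨a, rfl⟩ := hgs a
  obtain ⟨b, rfl⟩ := hgs b
  have : f a = f b := by rw [hg]; exact hab
  rw [hf.1 this]

/-- The comparison map is the composite `dX → dY → cY → cX`, whose outer arrows come from the
minimality of `d` at `Y` and of `c` at `X`. -/
theorem le_of_bijective (hc : IsCoveringOperator c) (hd : IsCoveringOperator d)
    {X Y : CompHaus.{u}} {f : C(Y, X)} (hf : Function.Bijective f) (h : c Y ≤ d Y) :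
    c X ≤ d X := by
  have hfh : IsHomeomorph f := isHomeomorph_iff_continuous_bijective.2 ⟨f.continuous, hf⟩
  let e : X ≃ₜ Y := (hfh.homeomorph f).symm
  let k : C(X, Y) := ⟨e, e.continuous⟩
  have hk : Function.Bijective k := e.bijective
  have hfk : f.comp k = ContinuousMap.id X :=
    ContinuousMap.ext fun x => (hfh.homeomorph f).apply_symm_apply x
  obtain ⟨g₁, hg₁⟩ := hc.minimum X ⟨(c Y).space, f.comp (c Y).map⟩
    ((OverSpace.isCover_of_bijective hf).comp (hc.isCover Y)) (hc.fix Y)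
  obtain ⟨g₂, hg₂⟩ := h
  obtain ⟨g₃, hg₃⟩ := hd.minimum Y ⟨(d X).space, k.comp (d X).map⟩
    ((OverSpace.isCover_of_bijective hk).comp (hd.isCover X)) (hd.fix X)
  refine ⟨g₁.comp (g₂.comp g₃), ?_⟩
  change f.comp (c Y).map = (c X).map.comp g₁ at hg₁
  change k.comp (d X).map = (d Y).map.comp g₃ at hg₃
  rw [← ContinuousMap.comp_assoc, ← hg₁, ContinuousMap.comp_assoc, ← ContinuousMap.comp_assoc _ g₂,
    ← hg₂, ← hg₃, ← ContinuousMap.comp_assoc, hfk, ContinuousMap.id_comp]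

end IsCoveringOperator

namespace Wstar

variable {A B C : Wstar.{u}}

/-! ## Morphisms -/

theorem Hom.ext {f g : Hom A B} (h : ∀ a, f a = g a) : f = g := by
  obtain ⟨f, _, _, _⟩ := f
  obtain ⟨g, _, _, _⟩ := g
  obtain rfl : f = g := LinearMap.ext h
  rfl

theorem Hom.congr {f g : Hom A B} (h : f = g) (a : A) : f a = g a := by rw [h]

theorem Hom.map_sub (f : Hom A B) (x y : A) : f (x - y) = f x - f y :=
  f.toLinearMap.map_sub x y

theorem Hom.map_neg (f : Hom A B) (x : A) : f (-x) = -f x := f.toLinearMap.map_neg x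

theorem Hom.map_zero (f : Hom A B) : f 0 = 0 := f.toLinearMap.map_zero

theorem Hom.map_abs (f : Hom A B) (x : A) : f |x| = |f x| := by
  rw [abs, abs, f.map_sup, f.map_neg]

theorem Hom.injective_iff (f : Hom A B) : Function.Injective f ↔ ∀ a, f a = 0 → a = 0 :=
  injective_iff_map_eq_zero f.toLinearMap

variable (A) in
/-- The identity morphism. -/
def Hom.id : Hom A A where
  toLinearMap := LinearMap.id
  map_sup _ _ := rfl
  map_inf _ _ := rfl
  map_unit := rfl

/-- If the range of `f` lies in the range of the injective `g`, then `f` factors over `g`. -/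
theorem Hom.exists_factor {g : Hom B C} (hg : Function.Injective g) (f : Hom A C)
    (h : ∀ a, ∃ b, g b = f a) : ∃ k : Hom A B, f = g.comp k := by
  choose k hk using h
  refine ⟨{ toFun := k, map_add' := ?_, map_smul' := ?_, map_sup := ?_, map_inf := ?_,
            map_unit := ?_ }, Hom.ext fun a => (hk a).symm⟩
  · intro x y
    refine hg ?_
    rw [hk, g.map_add', hk, hk, f.map_add']
  · intro r x
    refine hg ?_
    rw [hk, g.map_smul', hk, f.map_smul']
    rfl
  · intro x y
    refine hg ?_
    rw [hk, g.map_sup, hk, hk, f.map_sup]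
  · intro x y
    refine hg ?_
    rw [hk, g.map_inf, hk, hk, f.map_inf]
  · refine hg ?_
    rw [hk, g.map_unit, f.map_unit]

theorem Hom.exists_inverse {f : Hom A B} (hf : Function.Bijective f) :
    ∃ k : Hom B A, (∀ b, f (k b) = b) ∧ ∀ a, k (f a) = a := by
  obtain ⟨k, hk⟩ := Hom.exists_factor hf.1 (Hom.id B) hf.2
  have h1 : ∀ b, f (k b) = b := fun b => (Hom.congr hk b).symm
  exact ⟨k, h1, fun a => hf.1 (h1 _)⟩

/-! ## Points of the Yosida space as characters -/

theorem value_sub (a b : A) (M : MaxIdeal A) : value (a - b) M = value a M - value b M := by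
  rw [sub_eq_add_neg, value_add, value_neg, sub_eq_add_neg]

theorem value_zero (M : MaxIdeal A) : value (0 : A) M = 0 :=
  (value_eq_zero_iff _ _).2 M.1.zero_mem

theorem value_abs (a : A) (M : MaxIdeal A) : value |a| M = |value a M| := by
  rw [abs, abs, value_sup, value_neg]

theorem value_mono {a b : A} (h : a ≤ b) (M : MaxIdeal A) : value a M ≤ value b M := by
  rw [← sup_eq_right, ← value_sup, sup_eq_right.2 h]

theorem MaxIdeal.ext {M N : MaxIdeal A} (h : ∀ a, value a M = value a N) : M = N :=
  Subtype.ext (Submodule.ext fun a => by rw [← value_eq_zero_iff, ← value_eq_zero_iff, h])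

/-- The kernel of `χ` is an ideal, and modulo it each `a` is `χ a` times the unit. A larger ideal
therefore contains a nonzero multiple of the unit. -/
theorem exists_maxIdeal_of_character (χ : A →ₗ[ℝ] ℝ) (hsup : ∀ a b, χ (a ⊔ b) = χ a ⊔ χ b)
    (hunit : χ A.unit = 1) : ∃ M : MaxIdeal A, ∀ a, value a M = χ a := by
  have habs : ∀ a, χ |a| = |χ a| := fun a => by rw [abs, abs, hsup, map_neg]
  have hmono : ∀ {a b}, a ≤ b → χ a ≤ χ b := fun {a b} h => by
    rw [← sup_eq_right, ← hsup, sup_eq_right.2 h]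
  have hval : ∀ a, a - χ a • A.unit ∈ LinearMap.ker χ := fun a => by
    rw [LinearMap.mem_ker, map_sub, map_smul, hunit]; simp
  refine ⟨⟨LinearMap.ker χ, ?_, ?_, ?_⟩, fun a => value_eq (hval a)⟩
  · intro x y hy hxy
    have h1 := hmono hxy
    rw [habs, habs, LinearMap.mem_ker.1 hy, abs_zero] at h1
    exact abs_nonpos_iff.1 h1
  · rw [LinearMap.mem_ker, hunit]
    exact one_ne_zero
  · refine fun I _ hu hle => le_antisymm (fun a ha => ?_) hle
    by_contra hne
    have h1 := I.sub_mem ha (hle (hval a))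
    rw [sub_sub_cancel] at h1
    exact hu ((Submodule.smul_mem_iff I hne).1 h1)

/-- The real value of an element of `C(X)` at a point. -/
def eval {X : CompHaus.{u}} (f : ofC X) (x : X) : ℝ := (show C(X, ℝ) from f) x

/-! ### Pointwise evaluation in `C(X)` -/

section eval
variable {X Y : CompHaus.{u}}

theorem eval_ext {f g : ofC X} (h : ∀ x, eval f x = eval g x) : f = g := ContinuousMap.ext h
theorem eval_sup (f g : ofC X) (x : X) : eval (f ⊔ g) x = eval f x ⊔ eval g x := rfl
theorem eval_inf (f g : ofC X) (x : X) : eval (f ⊓ g) x = eval f x ⊓ eval g x := rfl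
theorem eval_add (f g : ofC X) (x : X) : eval (f + g) x = eval f x + eval g x := rfl
theorem eval_neg (f : ofC X) (x : X) : eval (-f) x = -eval f x := rfl
theorem eval_sub (f g : ofC X) (x : X) : eval (f - g) x = eval f x - eval g x := rfl
theorem eval_zero (x : X) : eval (0 : ofC X) x = 0 := rfl
theorem eval_unit (x : X) : eval (ofC X).unit x = 1 := rfl
theorem eval_abs (f : ofC X) (x : X) : eval |f| x = |eval f x| := by
  rw [abs, abs, eval_sup, eval_neg]
theorem continuous_eval (f : ofC X) : Continuous (eval f) := (show C(X, ℝ) from f).continuous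
theorem eval_pullback (τ : C(Y, X)) (f : ofC X) (y : Y) :
    eval (pullback τ f) y = eval f (τ y) := rfl
theorem eval_yosidaHom (a : A) (M : A.yosidaSpace) : eval (yosidaHom A a) M = value a M := rfl

/-- An element of `C(X)` from a continuous function. -/
def mkC (f : X → ℝ) (hf : Continuous f) : ofC X := (⟨f, hf⟩ : C(X, ℝ))

theorem eval_mkC (f : X → ℝ) (hf : Continuous f) (x : X) : eval (mkC f hf) x = f x := rfl

end eval

theorem abs_inf_abs_eq_zero {s t : ℝ} : |s| ⊓ |t| = 0 ↔ s = 0 ∨ t = 0 := by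
  constructor
  · intro h
    rcases min_choice |s| |t| with hl | hl
    · exact Or.inl (abs_eq_zero.1 (hl.symm.trans h))
    · exact Or.inr (abs_eq_zero.1 (hl.symm.trans h))
  · rintro (h | h) <;> rw [h, abs_zero]
    · exact inf_eq_left.2 (abs_nonneg _)
    · exact inf_eq_right.2 (abs_nonneg _)

theorem mul_inf_eq_zero {s t w : ℝ} (hst : s ⊓ t = 0) (hw : 0 ≤ w) : (w * s) ⊓ t = 0 := by
  have hs : 0 ≤ s := hst.symm.le.trans inf_le_left
  have ht : 0 ≤ t := hst.symm.le.trans inf_le_right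
  rcases min_choice s t with hl | hl
  · have h0 : s = 0 := hl.symm.trans hst
    rw [h0, mul_zero]
    exact inf_eq_left.2 ht
  · have h0 : t = 0 := hl.symm.trans hst
    rw [h0]
    exact inf_eq_right.2 (mul_nonneg hw hs)

/-! ## Density of cozero sets and injectivity of the Yosida representation -/

/-- Cozero sets are closed under intersection: those of `a` and `b` meet in the one of `|a| ⊓ |b|`.
-/
theorem isTopologicalBasis_cozero :
    TopologicalSpace.IsTopologicalBasis
      (insert Set.univ {U : Set (MaxIdeal A) | ∃ a : A, U = {M | a ∉ M.1}}) := by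
  refine TopologicalSpace.isTopologicalBasis_of_subbasis_of_inter rfl ?_
  rintro _ ⟨a, rfl⟩ _ ⟨b, rfl⟩
  refine ⟨|a| ⊓ |b|, Set.ext fun M => ?_⟩
  have h : value (|a| ⊓ |b|) M = 0 ↔ value a M = 0 ∨ value b M = 0 := by
    rw [value_inf, value_abs, value_abs, abs_inf_abs_eq_zero]
  simp only [Set.mem_inter_iff, Set.mem_ofPred_eq, ← value_eq_zero_iff, h, not_or]

theorem exists_cozero_subset {W : Set (MaxIdeal A)} (hW : IsOpen W) {M : MaxIdeal A} (hM : M ∈ W) :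
    ∃ a : A, value a M ≠ 0 ∧ ∀ N, value a N ≠ 0 → N ∈ W := by
  obtain ⟨U, hU, hMU, hUW⟩ := isTopologicalBasis_cozero.exists_subset_of_mem_open hM hW
  rcases hU with rfl | ⟨a, rfl⟩
  · exact ⟨A.unit, by rw [value_unit]; exact one_ne_zero, fun N _ => hUW (Set.mem_univ N)⟩
  · exact ⟨a, (value_eq_zero_iff a M).not.2 hMU, fun N h => hUW ((value_eq_zero_iff a N).not.1 h)⟩

theorem nsmul_inf_eq_zero {x y : A} (hx : 0 ≤ x) (hy : 0 ≤ y) (h : x ⊓ y = 0) (k : ℕ) :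
    (k • x) ⊓ y = 0 := by
  induction k with
  | zero => simpa using hy
  | succ k ih =>
    refine le_antisymm ?_ (le_inf (nsmul_nonneg hx _) hy)
    have e1 : (k + 1) • x ⊓ y ≤ k • x + x := by rw [← succ_nsmul]; exact inf_le_left
    have e2 : (k + 1) • x ⊓ y ≤ y := inf_le_right
    have e3 : (k + 1) • x ⊓ y - x ≤ k • x ⊓ y :=
      le_inf (sub_le_iff_le_add.2 e1) ((sub_le_self _ hx).trans e2)
    rw [ih, sub_nonpos] at e3
    exact (le_inf e3 e2).trans h.le

/-- An element whose values are all positive is positive. -/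
theorem nonneg_of_value_pos {c : A} (h : ∀ M : MaxIdeal A, 0 < value c M) : 0 ≤ c := by
  -- No point of the Yosida space contains `c⁺`, so `c⁺` generates the whole of `A`. Some multiple
  -- of it then dominates `c⁻`, which is disjoint from that multiple and so vanishes.
  have hu : A.unit ∈ idealSpan {c⁺} := by
    by_contra hu
    obtain ⟨M, hM⟩ := exists_isUnitMaximal (isIdeal_idealSpan {c⁺}) hu
    have h1 := (value_eq_zero_iff _ _).2 (hM (subset_idealSpan _ (Set.mem_singleton _)))
    rw [posPart_def, value_sup, value_zero, sup_eq_right] at h1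
    exact absurd h1 (not_le.2 (h M))
  obtain ⟨t, ht, n, hn⟩ := hu
  have h2 : ∑ a ∈ t, |a| ≤ c⁺ := by
    have : t ⊆ {c⁺} := fun a ha => Finset.mem_singleton.2 (ht ha)
    refine (Finset.sum_le_sum_of_subset_of_nonneg this fun a _ _ => abs_nonneg a).trans ?_
    rw [Finset.sum_singleton, abs_of_nonneg (posPart_nonneg c)]
  have h3 : A.unit ≤ n • c⁺ := by
    rw [abs_of_nonneg A.unit_nonneg] at hn
    exact hn.trans (nsmul_le_nsmul_right h2 n)
  obtain ⟨k, hk⟩ := A.strong c⁻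
  rw [abs_of_nonneg (negPart_nonneg c)] at hk
  have h4 : c⁻ ≤ (k * n) • c⁺ := by
    rw [mul_nsmul']
    exact hk.trans (nsmul_le_nsmul_right h3 k)
  have h5 := nsmul_inf_eq_zero (posPart_nonneg c) (negPart_nonneg c)
    (posPart_inf_negPart_eq_zero c) (k * n)
  rw [inf_eq_right.2 h4] at h5
  exact negPart_eq_zero.1 h5

/-- The Archimedean property enters here. All values of `unit - n • |a - b|` equal `1`, so this
element is nonnegative for every `n`. -/
theorem value_injective {a b : A} (h : ∀ M : MaxIdeal A, value a M = value b M) : a = b := by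
  rw [← sub_eq_zero]
  suffices hs : |a - b| = 0 from
    le_antisymm ((le_abs_self _).trans hs.le) (neg_nonpos.1 ((neg_le_abs _).trans hs.le))
  refine A.archimedean _ A.unit (abs_nonneg _) fun n => ?_
  rw [← sub_nonneg]
  refine nonneg_of_value_pos fun M => ?_
  have h0 : value |a - b| M = 0 := by rw [value_abs, value_sub, h M, sub_self, abs_zero]
  rw [value_sub, ← Nat.cast_smul_eq_nsmul ℝ, value_smul, h0, value_unit]
  norm_num

theorem yosidaHom_injective (A : Wstar.{u}) : Function.Injective (yosidaHom A) := fun _ _ h =>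
  value_injective fun M => congrArg (fun f : ofC (yosidaSpace A) => eval f M) h

/-! ## Duality -/

theorem continuous_of_value {X : Type*} [TopologicalSpace X] {t : X → MaxIdeal A}
    (h : ∀ a, Continuous fun x => value a (t x)) : Continuous t := by
  refine continuous_generateFrom_iff.2 ?_
  rintro _ ⟨a, rfl⟩
  have : t ⁻¹' {M | a ∉ M.1} = (fun x => value a (t x)) ⁻¹' {0}ᶜ := by
    ext x
    exact (value_eq_zero_iff a (t x)).not.symm
  rw [this]
  exact isOpen_compl_singleton.preimage (h a)

theorem exists_dual {X : CompHaus.{u}} (φ : Hom A (ofC X)) :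
    ∃ t : C(X, A.yosidaSpace), ∀ a x, value a (t x) = eval (φ a) x := by
  have h : ∀ x : X, ∃ M : MaxIdeal A, ∀ a, value a M = eval (φ a) x := fun x =>
    exists_maxIdeal_of_character
      { toFun := fun a => eval (φ a) x
        map_add' := fun a b => by rw [φ.map_add', eval_add]
        map_smul' := fun r a => by rw [φ.map_smul']; rfl }
      (fun a b => by
        change eval (φ (a ⊔ b)) x = _
        rw [φ.map_sup, eval_sup]; rfl)
      (by
        change eval (φ A.unit) x = _
        rw [φ.map_unit, eval_unit])
  choose t ht using h
  refine ⟨⟨t, continuous_of_value fun a => ?_⟩, fun a x => ht x a⟩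
  simp only [ht]
  exact continuous_eval _

/-- The continuous map `X → YA` dual to a morphism `A → C(X)`. -/
def dual {X : CompHaus.{u}} (φ : Hom A (ofC X)) : C(X, A.yosidaSpace) := (exists_dual φ).choose

theorem value_dual {X : CompHaus.{u}} (φ : Hom A (ofC X)) (a : A) (x : X) :
    value a (dual φ x) = eval (φ a) x := (exists_dual φ).choose_spec a x

theorem dual_eq {X : CompHaus.{u}} {φ : Hom A (ofC X)} {t : C(X, A.yosidaSpace)}
    (h : ∀ a x, eval (φ a) x = value a (t x)) : dual φ = t :=
  ContinuousMap.ext fun x => MaxIdeal.ext fun a => by rw [value_dual, h]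

theorem pullback_dual {X : CompHaus.{u}} (φ : Hom A (ofC X)) :
    φ = (pullback (dual φ)).comp (yosidaHom A) :=
  Hom.ext fun a => eval_ext fun x => (value_dual φ a x).symm

/-- The continuous map `YB → YA` dual to a morphism `A → B`. -/
def yosidaMap (φ : Hom A B) : C(B.yosidaSpace, A.yosidaSpace) := dual ((yosidaHom B).comp φ)

theorem value_yosidaMap (φ : Hom A B) (a : A) (M : B.yosidaSpace) :
    value a (yosidaMap φ M) = value (φ a) M := value_dual _ a M

theorem dual_comp {X : CompHaus.{u}} (φ : Hom A B) (ψ : Hom B (ofC X)) :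
    dual (ψ.comp φ) = (yosidaMap φ).comp (dual ψ) :=
  dual_eq fun a x => (value_dual ψ (φ a) x).symm.trans (value_yosidaMap φ a _).symm

theorem yosidaMap_comp (φ : Hom A B) (ψ : Hom B C) :
    yosidaMap (ψ.comp φ) = (yosidaMap φ).comp (yosidaMap ψ) :=
  dual_comp φ ((yosidaHom C).comp ψ)

/-- The range of the dual map is closed. If it misses a point, some nonzero element of `A` has its
cozero set off the range and is killed by `φ`. The converse holds because values separate the
elements of `A`. -/
theorem injective_iff_dual_surjective {X : CompHaus.{u}} (φ : Hom A (ofC X)) :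
    Function.Injective φ ↔ Function.Surjective (dual φ) := by
  constructor
  · intro h M
    by_contra hM
    have hcl : IsClosed (Set.range (dual φ)) := (isCompact_range (dual φ).continuous).isClosed
    obtain ⟨a, haM, ha⟩ := exists_cozero_subset (A := A) hcl.isOpen_compl (M := M) hM
    refine haM ?_
    have : a = 0 := (φ.injective_iff.1 h) a (eval_ext fun x => by
      rw [← value_dual, eval_zero]
      by_contra hne
      exact ha _ hne ⟨x, rfl⟩)
    rw [this]
    exact value_zero M
  · intro h a b hab
    refine value_injective fun M => ?_
    obtain ⟨x, rfl⟩ := h M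
    rw [value_dual, value_dual, hab]

theorem injective_iff_yosidaMap_surjective (φ : Hom A B) :
    Function.Injective φ ↔ Function.Surjective (yosidaMap φ) := by
  rw [yosidaMap, ← injective_iff_dual_surjective]
  exact ((yosidaHom_injective B).of_comp_iff φ).symm

/-- For closed `F ⊆ YB`, restriction `B → C(F)` is dual to the inclusion of `F`. If `F` maps onto
`YA`, the restriction is injective on `A`, hence on `B` by essentiality, and so `F` is everything.
Conversely, a map into the source of an irreducible map is onto as soon as the composite is. -/
theorem isEssential_iff (φ : Hom A B) :
    φ.IsEssential ↔ (OverSpace.mk B.yosidaSpace (yosidaMap φ)).IsCover := by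
  constructor
  · intro h
    refine OverSpace.isCover_mk ((injective_iff_yosidaMap_surjective φ).1 h.injective)
      fun F hF hFu => ?_
    have : CompactSpace F := isCompact_iff_compactSpace.1 hF.isCompact
    let i : C(CompHaus.of F, B.yosidaSpace) := ⟨Subtype.val, continuous_subtype_val⟩
    let g : Hom B (ofC (CompHaus.of F)) := (pullback i).comp (yosidaHom B)
    have hg : dual g = i := dual_eq fun a x => rfl
    have hgi : Function.Injective g := by
      refine h.essential _ g ((injective_iff_dual_surjective _).2 ?_)
      rw [dual_comp, hg]
      intro M
      obtain ⟨N, hN, hNM⟩ := (hFu ▸ Set.mem_univ M : M ∈ yosidaMap φ '' F)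
      exact ⟨⟨N, hN⟩, hNM⟩
    rw [injective_iff_dual_surjective, hg] at hgi
    refine Set.eq_univ_of_forall fun M => ?_
    obtain ⟨x, rfl⟩ := hgi M
    exact x.2
  · intro h
    refine ⟨(injective_iff_yosidaMap_surjective φ).2 h.surjective, fun C g hg => ?_⟩
    rw [injective_iff_yosidaMap_surjective] at hg ⊢
    rw [yosidaMap_comp] at hg
    exact h.surjective_of_comp hg

/-! ### The Yosida space of `C(X)` -/

/-- The canonical map `X → Y(C(X))`. -/
def pointMap (X : CompHaus.{u}) : C(X, (ofC X).yosidaSpace) := dual (Hom.id (ofC X))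

theorem value_pointMap {X : CompHaus.{u}} (f : ofC X) (x : X) :
    value f (pointMap X x) = eval f x := value_dual _ f x

/-- Urysohn functions separate points; surjectivity is duality applied to the identity, which is
injective. -/
theorem pointMap_bijective (X : CompHaus.{u}) : Function.Bijective (pointMap X) := by
  refine ⟨fun x y h => ?_, ?_⟩
  · by_contra hne
    have : T1Space X := T2Space.t1Space
    have : NormalSpace X := NormalSpace.of_compactSpace_r1Space
    obtain ⟨f, hf0, hf1, -⟩ := exists_continuous_zero_one_of_isClosed
      (isClosed_singleton (x := x)) (isClosed_singleton (x := y)) (by simpa using hne)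
    have h1 : eval (mkC f f.continuous) x = eval (mkC f f.continuous) y := by
      rw [← value_pointMap, h, value_pointMap]
    rw [eval_mkC, eval_mkC] at h1
    rw [hf0 rfl, hf1 rfl] at h1
    exact zero_ne_one h1
  · exact (injective_iff_dual_surjective _).1 Function.injective_id

theorem dual_eq_yosidaMap_comp {X : CompHaus.{u}} (φ : Hom A (ofC X)) :
    dual φ = (yosidaMap φ).comp (pointMap X) :=
  dual_comp φ (Hom.id _)

theorem isEssential_iff_dual {X : CompHaus.{u}} (φ : Hom A (ofC X)) :
    φ.IsEssential ↔ (OverSpace.mk X (dual φ)).IsCover := by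
  rw [isEssential_iff, dual_eq_yosidaMap_comp]
  exact ⟨fun h => h.comp (OverSpace.isCover_of_bijective (pointMap_bijective X)),
    fun h => h.of_comp (pointMap_bijective X).2⟩

theorem yosidaHom_ofC_bijective (X : CompHaus.{u}) : Function.Bijective (yosidaHom (ofC X)) := by
  refine ⟨yosidaHom_injective _, fun f => ?_⟩
  refine ⟨pullback (pointMap X) f, eval_ext fun M => ?_⟩
  obtain ⟨x, rfl⟩ := (pointMap_bijective X).2 M
  rw [eval_yosidaHom, value_pointMap, eval_pullback]

/-- Every morphism `C(X) → C(Y)` is composition with a continuous map `Y → X`. -/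
theorem exists_eq_pullback {X Y : CompHaus.{u}} (φ : Hom (ofC X) (ofC Y)) :
    ∃ τ : C(Y, X), φ = pullback τ := by
  have hh : IsHomeomorph (pointMap X) :=
    isHomeomorph_iff_continuous_bijective.2 ⟨(pointMap X).continuous, pointMap_bijective X⟩
  let e := hh.homeomorph (pointMap X)
  refine ⟨⟨fun y => e.symm (dual φ y), e.symm.continuous.comp (dual φ).continuous⟩,
    Hom.ext fun f => eval_ext fun y => ?_⟩
  rw [← value_dual, eval_pullback, ← value_pointMap]
  exact congrArg _ (e.apply_symm_apply _).symm

/-- If `ψ ∘ φ` is essential and `ψ` is injective, then `φ` is essential. -/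
theorem Hom.IsEssential.of_comp {φ : Hom A B} {ψ : Hom B C} (h : (ψ.comp φ).IsEssential)
    (hψ : Function.Injective ψ) : φ.IsEssential := by
  rw [isEssential_iff] at h ⊢
  rw [yosidaMap_comp] at h
  exact h.of_comp ((injective_iff_yosidaMap_surjective ψ).1 hψ)

end Wstar

section

open Wstar

/-! ## The hull operators `u` and `μ(c)` -/

namespace Wstar

theorem dual_yosidaHom (A : Wstar.{u}) : dual (yosidaHom A) = ContinuousMap.id A.yosidaSpace :=
  dual_eq fun _ _ => rfl

theorem dual_pullback_comp_yosidaHom {A : Wstar.{u}} {X : CompHaus.{u}}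
    (τ : C(X, A.yosidaSpace)) : dual ((pullback τ).comp (yosidaHom A)) = τ :=
  dual_eq fun _ _ => rfl

theorem pullback_yosidaMap_comp {A B : Wstar.{u}} (φ : Hom A B) :
    (pullback (yosidaMap φ)).comp (yosidaHom A) = (yosidaHom B).comp φ :=
  (pullback_dual ((yosidaHom B).comp φ)).symm

/-- If `ν_B` is bijective, then every extension of `A` to `C(YB)` over `φ : A → B` is one to `B`. -/
theorem exists_of_yosidaHom_bijective {A B D : Wstar.{u}} (hB : Function.Bijective (yosidaHom B))
    {φ : Hom A B} {i : Hom A D} {k : Hom D (ofC B.yosidaSpace)}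
    (h : (yosidaHom B).comp φ = k.comp i) : ∃ g : Hom D B, φ = g.comp i := by
  obtain ⟨e, -, he⟩ := Hom.exists_inverse hB
  refine ⟨e.comp k, Hom.ext fun a => ?_⟩
  have h1 : yosidaHom B (φ a) = k (i a) := Hom.congr h a
  rw [← he (φ a), h1]
  rfl

theorem pullback_injective {X Y : CompHaus.{u}} {τ : C(Y, X)} (hτ : Function.Surjective τ) :
    Function.Injective (pullback τ) := fun f g h => eval_ext fun x => by
  obtain ⟨y, rfl⟩ := hτ x
  rw [← eval_pullback, h, eval_pullback]

theorem pullback_surjective {X Y : CompHaus.{u}} {τ : C(Y, X)} (hτ : Function.Bijective τ) :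
    Function.Surjective (pullback τ) := by
  have hh : IsHomeomorph τ := isHomeomorph_iff_continuous_bijective.2 ⟨τ.continuous, hτ⟩
  let e := hh.homeomorph τ
  intro f
  refine ⟨pullback ⟨e.symm, e.symm.continuous⟩ f, eval_ext fun y => ?_⟩
  rw [eval_pullback, eval_pullback]
  exact congrArg _ (e.symm_apply_apply y)

/-- Every function on `Y` factors through `τ`, and the functions on `Y` separate its points. -/
theorem injective_of_pullback_surjective {X Y : CompHaus.{u}} {τ : C(Y, X)}
    (h : Function.Surjective (pullback τ)) : Function.Injective τ := by
  intro y z hyz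
  refine (pointMap_bijective Y).1 (MaxIdeal.ext fun f => ?_)
  obtain ⟨g, rfl⟩ := h f
  rw [value_pointMap, value_pointMap, eval_pullback, eval_pullback, hyz]

end Wstar

/-- The dual of `ν_A` is the identity of `YA`, which gives essentiality. A fixed object `P` is
`C(YP)`, which receives `C(YA)` by composition with `YP → YA`. -/
theorem isHullOperator_uniformCompletion : IsHullOperator uniformCompletion.{u} where
  isEssential A := by
    refine (isEssential_iff_dual (yosidaHom A)).2 ?_
    rw [dual_yosidaHom]
    exact OverSpace.isCover_of_bijective Function.bijective_id
  fix A := yosidaHom_ofC_bijective _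
  minimum A P _ hP :=
    exists_of_yosidaHom_bijective hP (pullback_yosidaMap_comp P.map).symm

section mu

variable {c d : CoverAssignment.{u}}

theorem uniformCompletion_le_mu (c : CoverAssignment.{u}) : uniformCompletion.{u} ≤ mu c :=
  fun A => ⟨pullback (c A.yosidaSpace).map, rfl⟩

/-- If `ν_A` followed by composition with `c_{YA}` is onto, then so is the second map, and `c_{YA}`
is injective. As the second map is itself injective, `ν_A` is onto too. -/
theorem bijective_of_mu_fix (hc : IsCoveringOperator c) {A : Wstar.{u}} (h : (mu c).Fix A) :
    c.Fix A.yosidaSpace ∧ Function.Bijective (yosidaHom A) := by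
  have hcover := hc.isCover A.yosidaSpace
  have hs : Function.Surjective (pullback (c A.yosidaSpace).map) := fun f => by
    obtain ⟨a, ha⟩ := h.2 f
    exact ⟨yosidaHom A a, ha⟩
  refine ⟨isHomeomorph_iff_continuous_bijective.2 ⟨(c A.yosidaSpace).map.continuous,
    injective_of_pullback_surjective hs, hcover.surjective⟩, yosidaHom_injective A, fun f => ?_⟩
  obtain ⟨a, ha⟩ := h.2 (pullback (c A.yosidaSpace).map f)
  exact ⟨a, pullback_injective hcover.surjective ha⟩

theorem isHullOperator_mu (hc : IsCoveringOperator c) : IsHullOperator (mu c) where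
  isEssential A := by
    refine (isEssential_iff_dual _).2 ?_
    change (OverSpace.mk _ (dual ((pullback (c A.yosidaSpace).map).comp (yosidaHom A)))).IsCover
    rw [dual_pullback_comp_yosidaHom]
    exact hc.isCover _
  fix A := by
    -- The Yosida space of `C(cYA)` is homeomorphic to `cYA`, which `c` fixes.
    have hX := hc.fix_of_bijective (pointMap_bijective _) (hc.fix A.yosidaSpace)
    have hb := (isHomeomorph_iff_continuous_bijective.1 hX).2
    have hν := yosidaHom_ofC_bijective (c A.yosidaSpace).space
    exact ⟨(pullback_injective hb.2).comp hν.1, (pullback_surjective hb).comp hν.2⟩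
  minimum A P hP hfix := by
    obtain ⟨hY, hν⟩ := bijective_of_mu_fix hc hfix
    -- The essential extension `P` is a cover `YP` of `YA` that is fixed by `c`, so `c_{YA}` lies
    -- below it.
    obtain ⟨g, hg⟩ := hc.minimum _ ⟨_, yosidaMap P.map⟩ ((isEssential_iff P.map).1 hP) hY
    refine exists_of_yosidaHom_bijective (k := pullback g) hν ?_
    change yosidaMap P.map = (c A.yosidaSpace).map.comp g at hg
    rw [← pullback_yosidaMap_comp, hg]
    rfl

theorem mu_mono (h : c ≤ d) : mu c ≤ mu d := fun A => by
  obtain ⟨g, hg⟩ := h A.yosidaSpace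
  refine ⟨pullback g, ?_⟩
  change (pullback (d A.yosidaSpace).map).comp _ = _
  rw [hg]
  rfl

/-- At the object `C(X)`, the comparison morphism is composition with a continuous map. This map
compares the two covers of `Y(C(X))`, and the homeomorphism with `X` carries the comparison over. -/
theorem le_of_mu_le_mu (hc : IsCoveringOperator c) (hd : IsCoveringOperator d)
    (h : mu c ≤ mu d) : c ≤ d := fun X => by
  have hh : IsHomeomorph (pointMap X) :=
    isHomeomorph_iff_continuous_bijective.2 ⟨(pointMap X).continuous, pointMap_bijective X⟩
  let e := (hh.homeomorph (pointMap X)).symm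
  refine hc.le_of_bijective hd (f := ⟨e, e.continuous⟩) e.bijective ?_
  obtain ⟨g, hg⟩ := h (ofC X)
  obtain ⟨τ, rfl⟩ := exists_eq_pullback g
  refine ⟨τ, ?_⟩
  rw [← dual_pullback_comp_yosidaHom (d (ofC X).yosidaSpace).map]
  refine dual_eq fun a x => ?_
  exact congrArg (fun f : ofC (d (ofC X).yosidaSpace).space => eval f x) (Hom.congr hg a)

/-- An object fixed by a hull operator in the range of `μ` is uniformly complete. -/
theorem yosidaHom_bijective_of_mu_le (hc : IsCoveringOperator c) {h : HullAssignment.{u}}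
    (hle : mu c ≤ h) {A : Wstar.{u}} (hA : h.Fix A) : Function.Bijective (yosidaHom A) := by
  obtain ⟨g, hg⟩ := hle A
  obtain ⟨e, -, he⟩ := Hom.exists_inverse hA
  have hk : ∀ a, (e.comp g) ((mu c A).map a) = a := fun a => by
    have := Hom.congr hg a
    exact (congrArg e this).symm.trans (he a)
  -- A left inverse of an essential embedding is injective, so the embedding `μ(c)_A` is onto.
  have hinj : Function.Injective (e.comp g) :=
    ((isHullOperator_mu hc).isEssential A).essential _ _ fun a b hab => by
      have hab' : (e.comp g) ((mu c A).map a) = (e.comp g) ((mu c A).map b) := hab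
      rwa [hk, hk] at hab'
  refine (bijective_of_mu_fix hc ⟨((isHullOperator_mu hc).isEssential A).injective, fun f => ?_⟩).2
  exact ⟨(e.comp g) f, hinj (hk _)⟩

end mu

namespace Wstar

/-! ## Subobjects -/

/-- A subobject: a linear sublattice that contains the unit. -/
structure IsSub {B : Wstar.{u}} (S : Submodule ℝ B) : Prop where
  unit_mem : B.unit ∈ S
  sup_mem : ∀ x ∈ S, ∀ y ∈ S, x ⊔ y ∈ S

theorem IsSub.inf_mem {B : Wstar.{u}} {S : Submodule ℝ B} (hS : IsSub S) {x y : B} (hx : x ∈ S)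
    (hy : y ∈ S) : x ⊓ y ∈ S := by
  have : x ⊓ y = -(-x ⊔ -y) := by rw [neg_sup, neg_neg, neg_neg]
  rw [this]
  exact S.neg_mem (hS.sup_mem _ (S.neg_mem hx) _ (S.neg_mem hy))

/-- A subobject as an object. -/
def subObj {B : Wstar.{u}} (S : Submodule ℝ B) (hS : IsSub S) : Wstar.{u} where
  carrier := S
  instLattice := Subtype.lattice (fun _ _ hx hy => hS.sup_mem _ hx _ hy) fun _ _ hx hy =>
    hS.inf_mem hx hy
  instIsOrderedAddMonoid :=
    { add_le_add_left := fun a b h c => by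
        change a.1 + c.1 ≤ b.1 + c.1
        exact add_le_add_left (show a.1 ≤ b.1 from h) c.1 }
  instPosSMulMono := ⟨fun r hr a b h => by
    change r • a.1 ≤ r • b.1
    exact smul_le_smul_of_nonneg_left (show a.1 ≤ b.1 from h) hr⟩
  archimedean x y hx h := Subtype.ext (B.archimedean x.1 y.1 hx h)
  unit := ⟨B.unit, hS.unit_mem⟩
  unit_nonneg := B.unit_nonneg
  strong x := by
    obtain ⟨n, hn⟩ := B.strong x.1
    exact ⟨n, hn⟩

/-- The inclusion of a subobject. -/
def subIncl {B : Wstar.{u}} (S : Submodule ℝ B) (hS : IsSub S) : Hom (subObj S hS) B where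
  toLinearMap := S.subtype
  map_sup _ _ := rfl
  map_inf _ _ := rfl
  map_unit := rfl

theorem subIncl_injective {B : Wstar.{u}} (S : Submodule ℝ B) (hS : IsSub S) :
    Function.Injective (subIncl S hS) := Subtype.val_injective

/-! ### Subobjects generated under a binary operation -/

section opClosure

variable {A B D : Wstar.{u}} {op : B → B → B} {φ : Hom A B}

/-- `S` is a subobject that contains the range of `φ` and is closed under `op`. -/
structure IsOpClosed (op : B → B → B) (φ : Hom A B) (S : Submodule ℝ B) : Prop extends IsSub S where
  range_mem : ∀ a, φ a ∈ S
  op_mem : ∀ x ∈ S, ∀ y ∈ S, op x y ∈ S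

/-- The smallest subobject that contains the range of `φ` and is closed under `op`. -/
def opClosure (op : B → B → B) (φ : Hom A B) : Submodule ℝ B := sInf {S | IsOpClosed op φ S}

theorem opClosure_le {S : Submodule ℝ B} (h : IsOpClosed op φ S) : opClosure op φ ≤ S := sInf_le h

theorem isOpClosed_opClosure (op : B → B → B) (φ : Hom A B) :
    IsOpClosed op φ (opClosure op φ) where
  unit_mem := Submodule.mem_sInf.2 fun _ hS => hS.unit_mem
  sup_mem x hx y hy := Submodule.mem_sInf.2 fun _ hS =>
    hS.sup_mem x (opClosure_le hS hx) y (opClosure_le hS hy)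
  range_mem a := Submodule.mem_sInf.2 fun _ hS => hS.range_mem a
  op_mem x hx y hy := Submodule.mem_sInf.2 fun _ hS =>
    hS.op_mem x (opClosure_le hS hx) y (opClosure_le hS hy)

variable (op φ) in
/-- The object generated by the range of `φ` under `op`. -/
def generated : Wstar.{u} := subObj (opClosure op φ) (isOpClosed_opClosure op φ).toIsSub

variable (op φ) in
/-- The inclusion of the generated object. -/
def generatedIncl : Hom (generated op φ) B := subIncl _ _

theorem generatedIncl_injective : Function.Injective (generatedIncl op φ) := subIncl_injective _ _

variable (op φ) in
theorem exists_generatedMap : ∃ i : Hom A (generated op φ), φ = (generatedIncl op φ).comp i :=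
  Hom.exists_factor generatedIncl_injective φ
    fun a => ⟨⟨φ a, (isOpClosed_opClosure op φ).range_mem a⟩, rfl⟩

variable (op φ) in
/-- The morphism to the generated object. -/
def generatedMap : Hom A (generated op φ) := (exists_generatedMap op φ).choose

variable (op φ) in
theorem generatedIncl_comp_generatedMap :
    (generatedIncl op φ).comp (generatedMap op φ) = φ := (exists_generatedMap op φ).choose_spec.symm

theorem generatedIncl_mem (x : generated op φ) : generatedIncl op φ x ∈ opClosure op φ := x.2

variable (op φ) in
/-- The operation of the generated object. -/
def generatedOp (x y : generated op φ) : generated op φ :=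
  ⟨op x.1 y.1, (isOpClosed_opClosure op φ).op_mem _ x.2 _ y.2⟩

/-- If `k` maps the range of `φ` to the range of the injective `g`, and if the preimage under `k` of
the range of `g` is closed under `op`, then `k` restricts to a morphism from the generated object. -/
theorem exists_generated_lift {E : Wstar.{u}} {k : Hom B E} {g : Hom D E}
    (hg : Function.Injective g) (hφ : ∀ a, ∃ d, g d = k (φ a))
    (hop : ∀ x y, (∃ d, g d = k x) → (∃ d, g d = k y) → ∃ d, g d = k (op x y)) :
    ∃ l : Hom (generated op φ) D, k.comp (generatedIncl op φ) = g.comp l := by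
  refine Hom.exists_factor hg _ fun x => ?_
  have hcl : IsOpClosed op φ ((LinearMap.range g.toLinearMap).comap k.toLinearMap) :=
    { unit_mem := ⟨D.unit, by
        change g D.unit = k B.unit
        rw [g.map_unit, k.map_unit]⟩
      sup_mem := by
        rintro x ⟨d, hd⟩ y ⟨d', hd'⟩
        refine ⟨d ⊔ d', ?_⟩
        change g (d ⊔ d') = k (x ⊔ y)
        rw [g.map_sup, k.map_sup]
        exact congrArg₂ _ hd hd'
      range_mem := hφ
      op_mem := fun x hx y hy => hop x y hx hy }
  exact opClosure_le hcl (generatedIncl_mem x)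

/-- Points of the generated object that agree on `A` are equal, when `op` respects this. -/
theorem generated_point_ext {N N' : MaxIdeal (generated op φ)}
    (h : ∀ a, value (generatedMap op φ a) N = value (generatedMap op φ a) N')
    (hop : ∀ x y, value x N = value x N' → value y N = value y N' →
      value (generatedOp op φ x y) N = value (generatedOp op φ x y) N') : N = N' := by
  let S : Submodule ℝ (generated op φ) :=
    { carrier := {x | value x N = value x N'}
      zero_mem' := by
        change value 0 N = value 0 N'
        rw [value_zero, value_zero]
      add_mem' := fun {x y} (hx : value x N = value x N') (hy : value y N = value y N') => by
        change value (x + y) N = value (x + y) N'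
        rw [value_add, value_add, hx, hy]
      smul_mem' := fun r x (hx : value x N = value x N') => by
        change value (r • x) N = value (r • x) N'
        rw [value_smul, value_smul, hx] }
  have hS : ∀ x, x ∈ S ↔ value x N = value x N' := fun _ => Iff.rfl
  -- The elements on which the two points agree form a subobject closed under `op`, so by minimality
  -- they are all of the generated object.
  have hcl : IsOpClosed op φ (S.map (generatedIncl op φ).toLinearMap) :=
    { unit_mem := ⟨(generated op φ).unit, by
        rw [SetLike.mem_coe, hS, value_unit, value_unit], (generatedIncl op φ).map_unit⟩
      sup_mem := by
        rintro _ ⟨x, hx, rfl⟩ _ ⟨y, hy, rfl⟩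
        rw [SetLike.mem_coe, hS] at hx hy
        exact ⟨x ⊔ y, by rw [SetLike.mem_coe, hS, value_sup, value_sup, hx, hy],
          (generatedIncl op φ).map_sup x y⟩
      range_mem := fun a => ⟨generatedMap op φ a, h a,
        Hom.congr (generatedIncl_comp_generatedMap op φ) a⟩
      op_mem := by
        rintro _ ⟨x, hx, rfl⟩ _ ⟨y, hy, rfl⟩
        exact ⟨generatedOp op φ x y, hop x y hx hy, rfl⟩ }
  refine MaxIdeal.ext fun x => ?_
  obtain ⟨y, hy, hyx⟩ := opClosure_le hcl (generatedIncl_mem x)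
  rw [← generatedIncl_injective hyx]
  exact hy

end opClosure

/-! ## `f`-rings -/

section fring

variable {A B : Wstar.{u}}

theorem IsFRing.of_bijective {e : Hom A B} (he : Function.Bijective e) (hB : B.IsFRing) :
    A.IsFRing := by
  obtain ⟨k, hek, hke⟩ := Hom.exists_inverse he
  obtain ⟨m, hassoc, hul, hur, hpos, hf⟩ := hB
  have hm : ∀ x y, ((m.compl₁₂ e.toLinearMap e.toLinearMap).compr₂ k.toLinearMap) x y =
    k (m (e x) (e y)) := fun _ _ => rfl
  have hnn : ∀ {C D : Wstar.{u}} (f : Hom C D) {x : C}, 0 ≤ x → 0 ≤ f x := fun f x hx => by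
    rw [← sup_eq_right, ← f.map_zero, ← f.map_sup, sup_eq_right.2 hx]
  have hinf : ∀ {x y : A}, x ⊓ y = 0 → e x ⊓ e y = 0 := fun {x y} h => by
    rw [← e.map_inf, h, e.map_zero]
  refine ⟨(m.compl₁₂ e.toLinearMap e.toLinearMap).compr₂ k.toLinearMap, ?_, ?_, ?_, ?_, ?_⟩
  · intro x y z
    rw [hm, hm, hm, hm, hek, hek, hassoc]
  · intro x
    rw [hm, e.map_unit, hul, hke]
  · intro x
    rw [hm, e.map_unit, hur, hke]
  · intro x y hx hy
    rw [hm]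
    exact hnn k (hpos _ _ (hnn e hx) (hnn e hy))
  · intro x y z hxy hz
    obtain ⟨h1, h2⟩ := hf _ _ (e z) (hinf hxy) (hnn e hz)
    rw [hm, hm]
    refine ⟨?_, ?_⟩
    · rw [← hke y, ← k.map_inf, h1, k.map_zero]
    · rw [← hke y, ← k.map_inf, h2, k.map_zero]

/-- In an archimedean `f`-ring with the unit as its identity, the multiplication is pointwise. -/
theorem value_mul (m : A →ₗ[ℝ] A →ₗ[ℝ] A) (hul : ∀ x, m A.unit x = x) (hur : ∀ x, m x A.unit = x)
    (hpos : ∀ x y, 0 ≤ x → 0 ≤ y → 0 ≤ m x y) (x y : A) (M : MaxIdeal A) :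
    value (m x y) M = value x M * value y M := by
  have hI := M.2.isIdeal
  -- From `q ≤ k • unit` and positivity, `0 ≤ m p q ≤ k • p`, so the order ideal absorbs products.
  have key : ∀ p q : A, p ∈ M.1 → 0 ≤ p → 0 ≤ q → m p q ∈ M.1 := by
    intro p q hp hp0 hq0
    obtain ⟨k, hk⟩ := A.strong q
    rw [abs_of_nonneg hq0] at hk
    refine hI.of_le (y := k • p) (M.1.smul_of_tower_mem k hp) (hpos p q hp0 hq0) ?_
    have h1 := hpos p (k • A.unit - q) hp0 (sub_nonneg.2 hk)
    rw [map_sub, map_nsmul, hur, sub_nonneg] at h1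
    exact h1
  have hparts : ∀ p ∈ M.1, p⁺ ∈ M.1 ∧ p⁻ ∈ M.1 := fun p hp =>
    ⟨hI.of_abs_le (hI.abs_mem hp) (by
      rw [abs_of_nonneg (posPart_nonneg p)]
      exact sup_le (le_abs_self p) (abs_nonneg p)),
    hI.of_abs_le (hI.abs_mem hp) (by
      rw [abs_of_nonneg (negPart_nonneg p)]
      exact sup_le (neg_le_abs p) (abs_nonneg p))⟩
  have key' : ∀ p q : A, p ∈ M.1 → m p q ∈ M.1 := by
    intro p q hp
    obtain ⟨h1, h2⟩ := hparts p hp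
    have hexp : ∀ a b c d : A, m (a - b) (c - d) = m a c - m a d - (m b c - m b d) := by
      intro a b c d
      simp only [map_sub, LinearMap.sub_apply]
      abel
    rw [← posPart_sub_negPart p, ← posPart_sub_negPart q, hexp]
    exact M.1.sub_mem
      (M.1.sub_mem (key _ _ h1 (posPart_nonneg p) (posPart_nonneg q))
        (key _ _ h1 (posPart_nonneg p) (negPart_nonneg q)))
      (M.1.sub_mem (key _ _ h2 (negPart_nonneg p) (posPart_nonneg q))
        (key _ _ h2 (negPart_nonneg p) (negPart_nonneg q)))
  -- Absorption is applied to `x - value x M • unit`, which lies in the ideal; its product with `y`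
  -- has value zero.
  have h := (value_eq_zero_iff _ _).2 (key' _ y (value_spec x M))
  rw [map_sub, LinearMap.sub_apply, map_smul, LinearMap.smul_apply, hul, value_sub,
    value_smul] at h
  linarith

end fring

/-- The pointwise product on `C(X)`. -/
def mulC {X : CompHaus.{u}} (f g : ofC X) : ofC X :=
  mkC (fun x => eval f x * eval g x) ((continuous_eval f).mul (continuous_eval g))

/-! ### Order, disjointness and products tested pointwise -/

section pointwise

variable {A : Wstar.{u}} {X : CompHaus.{u}} {ψ : Hom A (ofC X)}

theorem eq_of_eval (hψ : Function.Injective ψ) {a b : A}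
    (h : ∀ x, eval (ψ a) x = eval (ψ b) x) : a = b := hψ (eval_ext h)

theorem nonneg_of_eval (hψ : Function.Injective ψ) {a : A} (h : ∀ x, 0 ≤ eval (ψ a) x) :
    0 ≤ a := by
  rw [← sup_eq_right]
  refine eq_of_eval hψ fun x => ?_
  rw [ψ.map_sup, eval_sup, ψ.map_zero, eval_zero, sup_eq_right.2 (h x)]

theorem eval_nonneg {a : A} (h : 0 ≤ a) (x : X) : 0 ≤ eval (ψ a) x := by
  rw [← sup_eq_right, ← eval_zero x, ← ψ.map_zero, ← eval_sup, ← ψ.map_sup, sup_eq_right.2 h]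

theorem inf_eq_zero_iff_eval (hψ : Function.Injective ψ) {a b : A} :
    a ⊓ b = 0 ↔ ∀ x, eval (ψ a) x ⊓ eval (ψ b) x = 0 := by
  constructor
  · intro h x
    rw [← eval_inf, ← ψ.map_inf, h, ψ.map_zero, eval_zero]
  · intro h
    refine eq_of_eval hψ fun x => ?_
    rw [ψ.map_inf, eval_inf, h, ψ.map_zero, eval_zero]

theorem disjoint_iff_eval (hψ : Function.Injective ψ) {a b : A} :
    |a| ⊓ |b| = 0 ↔ ∀ x, eval (ψ a) x = 0 ∨ eval (ψ b) x = 0 := by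
  rw [inf_eq_zero_iff_eval hψ]
  refine forall_congr' fun x => ?_
  rw [ψ.map_abs, ψ.map_abs, eval_abs, eval_abs, abs_inf_abs_eq_zero]

/-- A pointwise product on `A`, embedded in `C(X)`, as a bilinear map. -/
theorem exists_mul (hψ : Function.Injective ψ) {op : A → A → A}
    (hop : ∀ a b x, eval (ψ (op a b)) x = eval (ψ a) x * eval (ψ b) x) :
    ∃ m : A →ₗ[ℝ] A →ₗ[ℝ] A, (∀ a b, m a b = op a b) ∧
      (∀ x y z, m (m x y) z = m x (m y z)) ∧
      (∀ x, m A.unit x = x) ∧ (∀ x, m x A.unit = x) ∧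
      (∀ x y, 0 ≤ x → 0 ≤ y → 0 ≤ m x y) ∧
      (∀ x y z, x ⊓ y = 0 → 0 ≤ z → m z x ⊓ y = 0 ∧ m x z ⊓ y = 0) := by
  have hadd : ∀ a b x, eval (ψ (a + b)) x = eval (ψ a) x + eval (ψ b) x := fun a b x => by
    rw [ψ.map_add', eval_add]
  have hsmul : ∀ (r : ℝ) a x, eval (ψ (r • a)) x = r * eval (ψ a) x := fun r a x => by
    rw [ψ.map_smul']; rfl
  have hunit : ∀ x, eval (ψ A.unit) x = 1 := fun x => by rw [ψ.map_unit, eval_unit]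
  refine ⟨LinearMap.mk₂ ℝ op ?_ ?_ ?_ ?_, fun _ _ => rfl, ?_, ?_, ?_, ?_, ?_⟩
  · intro a b c
    refine eq_of_eval hψ fun x => ?_
    rw [hop, hadd, hadd, hop, hop, add_mul]
  · intro r a b
    refine eq_of_eval hψ fun x => ?_
    rw [hop, hsmul, hsmul, hop, mul_assoc]
  · intro a b c
    refine eq_of_eval hψ fun x => ?_
    rw [hop, hadd, hadd, hop, hop, mul_add]
  · intro r a b
    refine eq_of_eval hψ fun x => ?_
    rw [hop, hsmul, hsmul, hop, mul_left_comm]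
  all_goals simp only [LinearMap.mk₂_apply]
  · intro a b c
    refine eq_of_eval hψ fun x => ?_
    rw [hop, hop, hop, hop, mul_assoc]
  · intro a
    refine eq_of_eval hψ fun x => ?_
    rw [hop, hunit, one_mul]
  · intro a
    refine eq_of_eval hψ fun x => ?_
    rw [hop, hunit, mul_one]
  · intro a b ha hb
    refine nonneg_of_eval hψ fun x => ?_
    rw [hop]
    exact mul_nonneg (eval_nonneg ha x) (eval_nonneg hb x)
  · intro a b c hab hc
    rw [inf_eq_zero_iff_eval hψ] at hab ⊢
    rw [inf_eq_zero_iff_eval hψ]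
    refine ⟨fun x => ?_, fun x => ?_⟩
    · rw [hop]
      exact mul_inf_eq_zero (hab x) (eval_nonneg hc x)
    · rw [hop, mul_comm]
      exact mul_inf_eq_zero (hab x) (eval_nonneg hc x)

end pointwise

/-! ## The ring reflection -/

variable {A : Wstar.{u}}

variable (A) in
/-- The vector lattice and ring generated by `A` in `C(YA)`. -/
def ringHull : Wstar.{u} := generated mulC (yosidaHom A)

variable (A) in
/-- The embedding of `A` into the ring that it generates. -/
def ringHullMap : Hom A (ringHull A) := generatedMap mulC (yosidaHom A)

variable (A) in
-- The first clause ties the bilinear product to the generating operation, so that `value_mul`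
-- applies to that operation.
theorem exists_ringHull_mul : ∃ m : ringHull A →ₗ[ℝ] ringHull A →ₗ[ℝ] ringHull A,
    (∀ a b, m a b = generatedOp mulC (yosidaHom A) a b) ∧
      (∀ x y z, m (m x y) z = m x (m y z)) ∧
      (∀ x, m (ringHull A).unit x = x) ∧ (∀ x, m x (ringHull A).unit = x) ∧
      (∀ x y, 0 ≤ x → 0 ≤ y → 0 ≤ m x y) ∧
      (∀ x y z, x ⊓ y = 0 → 0 ≤ z → m z x ⊓ y = 0 ∧ m x z ⊓ y = 0) :=
  exists_mul (ψ := generatedIncl mulC (yosidaHom A)) generatedIncl_injective fun _ _ _ => rfl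

variable (A) in
theorem isFRing_ringHull : (ringHull A).IsFRing := by
  obtain ⟨m, -, h⟩ := exists_ringHull_mul A
  exact ⟨m, h⟩

variable (A) in
-- By `value_mul` the product is pointwise at every point of the Yosida space of the generated ring.
-- Two points that agree on `A` therefore agree on everything generated from it.
theorem yosidaMap_ringHullMap_injective : Function.Injective (yosidaMap (ringHullMap A)) := by
  intro N N' h
  refine generated_point_ext (fun a => ?_) fun x y hx hy => ?_
  · change value (ringHullMap A a) N = value (ringHullMap A a) N'
    rw [← value_yosidaMap, h, value_yosidaMap]
  · obtain ⟨m, hm, -, hul, hur, hpos, -⟩ := exists_ringHull_mul A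
    have hxy : ∀ L, value (generatedOp mulC (yosidaHom A) x y) L = value x L * value y L :=
      fun L => (congrArg (fun z : ringHull A => value z L) (hm x y)).symm.trans
        (value_mul m hul hur hpos x y L)
    exact (hxy N).trans ((congrArg₂ _ hx hy).trans (hxy N').symm)

variable (A) in
theorem isEssential_ringHullMap : (ringHullMap A).IsEssential := by
  have hinj : Function.Injective (ringHullMap A) := by
    refine Function.Injective.of_comp (f := generatedIncl mulC (yosidaHom A)) ?_
    have := generatedIncl_comp_generatedMap mulC (yosidaHom A)
    intro a b hab
    refine yosidaHom_injective A ?_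
    rw [← this]
    exact hab
  exact (isEssential_iff _).2 (OverSpace.isCover_of_bijective
    ⟨yosidaMap_ringHullMap_injective A, (injective_iff_yosidaMap_surjective _).1 hinj⟩)

/-- By `value_mul`, the image of `R` in `C(YR)` is closed under pointwise products. Composition with
`YR → YA` therefore maps the ring generated by `A` into this image. -/
theorem exists_ringHull_lift {R : Wstar.{u}} (hR : R.IsFRing) (f : Hom A R) :
    ∃ g : Hom (ringHull A) R, f = g.comp (ringHullMap A) := by
  obtain ⟨m, -, hul, hur, hpos, -⟩ := hR
  have hf := pullback_yosidaMap_comp f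
  obtain ⟨l, hl⟩ := exists_generated_lift (op := mulC) (φ := yosidaHom A)
    (k := pullback (yosidaMap f)) (g := yosidaHom R) (yosidaHom_injective R)
    (fun a => ⟨f a, (Hom.congr hf a).symm⟩) (by
      rintro x y ⟨d, hd⟩ ⟨d', hd'⟩
      refine ⟨m d d', eval_ext fun M => ?_⟩
      exact (value_mul m hul hur hpos d d' M).trans (congrArg₂ (fun s t : ℝ => s * t)
        (congrArg (fun h : ofC R.yosidaSpace => eval h M) hd)
        (congrArg (fun h : ofC R.yosidaSpace => eval h M) hd')))
  refine ⟨l, Hom.ext fun a => yosidaHom_injective R ?_⟩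
  have h1 := Hom.congr hl (ringHullMap A a)
  have h2 := Hom.congr (generatedIncl_comp_generatedMap mulC (yosidaHom A)) a
  refine (Hom.congr hf a).symm.trans (Eq.trans ?_ h1)
  exact congrArg (pullback (yosidaMap f)) h2.symm

/-- The dual maps of `g` and `g'` agree after the injective map to `YA`, hence agree. -/
theorem ringHull_hom_ext {R : Wstar.{u}} {g g' : Hom (ringHull A) R}
    (h : g.comp (ringHullMap A) = g'.comp (ringHullMap A)) : g = g' := by
  refine Hom.ext fun x => value_injective fun M => ?_
  have hM : yosidaMap g M = yosidaMap g' M := by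
    refine yosidaMap_ringHullMap_injective A ?_
    have h1 : yosidaMap (g.comp (ringHullMap A)) M = yosidaMap (g'.comp (ringHullMap A)) M := by
      rw [h]
    rwa [yosidaMap_comp, yosidaMap_comp] at h1
  exact (value_yosidaMap g x M).symm.trans ((congrArg _ hM).trans (value_yosidaMap g' x M))

end Wstar

theorem exists_isRingReflection : ∃ r : HullAssignment.{u}, IsRingReflection r :=
  ⟨fun A => ⟨ringHull A, ringHullMap A⟩, fun A => isFRing_ringHull A, fun _ _ hR f => by
    obtain ⟨g, hg⟩ := exists_ringHull_lift hR f
    exact ⟨g, hg, fun g' hg' => ringHull_hom_ext (hg'.symm.trans hg)⟩⟩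

/-! ### Ring reflections as hull operators -/

namespace IsRingReflection

variable {r : HullAssignment.{u}}

theorem fix_of_isFRing (hr : IsRingReflection r) {A : Wstar.{u}} (hA : A.IsFRing) : r.Fix A := by
  obtain ⟨g, hg, -⟩ := hr.existsUnique A A hA (Hom.id A)
  have h1 : ∀ a, g ((r A).map a) = a := fun a => (Hom.congr hg a).symm
  obtain ⟨k, -, hk⟩ := hr.existsUnique A (r A).obj (hr.isFRing A) (r A).map
  have h2 : ((r A).map.comp g) = Hom.id _ :=
    (hk ((r A).map.comp g) (Hom.ext fun a => (congrArg (r A).map (h1 a)).symm)).trans (hk _ rfl).symm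
  exact ⟨Function.LeftInverse.injective h1, fun b => ⟨g b, Hom.congr h2 b⟩⟩

theorem isHullOperator (hr : IsRingReflection r) : IsHullOperator r where
  isEssential A := by
    obtain ⟨g, hg, -⟩ := hr.existsUnique A (ringHull A) (isFRing_ringHull A) (ringHullMap A)
    obtain ⟨k, hk⟩ := exists_ringHull_lift (hr.isFRing A) (r A).map
    obtain ⟨l, -, hl⟩ := hr.existsUnique A (r A).obj (hr.isFRing A) (r A).map
    -- Uniqueness of extensions makes `k ∘ g` the identity. So `rA` embeds over `A` in the concrete
    -- ring hull and inherits essentiality from it.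
    have hkg : k.comp g = Hom.id _ := by
      refine (hl _ (hk.trans ?_)).trans (hl _ rfl).symm
      rw [hg]
      rfl
    have hginj : Function.Injective g :=
      Function.LeftInverse.injective (g := k) fun x => Hom.congr hkg x
    refine Hom.IsEssential.of_comp (ψ := g) ?_ hginj
    rw [← hg]
    exact isEssential_ringHullMap A
  fix A := hr.fix_of_isFRing (hr.isFRing A)
  minimum A P _ hfix :=
    (hr.existsUnique A P.obj (IsFRing.of_bijective hfix (hr.isFRing _)) P.map).exists

end IsRingReflection

namespace Wstar

/-! ## The projectable hull -/

section proj

variable {X : CompHaus.{u}}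

/-- The set where `f` does not vanish. -/
def coz (f : ofC X) : Set X := {x | eval f x ≠ 0}

theorem isOpen_coz (f : ofC X) : IsOpen (coz f) := isOpen_ne_fun (continuous_eval f)
  continuous_const

theorem eval_eq_zero_of_mem_closure {f g : ofC X} (h : ∀ x, eval f x = 0 ∨ eval g x = 0) {x : X}
    (hx : x ∈ closure (coz g)) : eval f x = 0 := by
  have hcl : IsClosed {x : X | eval f x = 0} := isClosed_eq (continuous_eval f) continuous_const
  exact closure_minimal (fun y hy => (h y).resolve_right hy) hcl hx

theorem eval_eq_zero_of_notMem_closure {f : ofC X} {x : X} (hx : x ∉ closure (coz f)) :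
    eval f x = 0 := by
  by_contra h
  exact hx (subset_closure h)

variable [ExtremallyDisconnected X]

/-- In an extremally disconnected space the closure of an open set is clopen, so its frontier is
empty. -/
theorem continuous_indicator_closure_coz (b f : ofC X) :
    Continuous ((closure (coz b)).indicator (eval f)) := by
  have hc : IsClopen (closure (coz b)) :=
    ⟨isClosed_closure, ExtremallyDisconnected.open_closure _ (isOpen_coz b)⟩
  exact Continuous.indicator (fun x hx => by rw [hc.frontier_eq] at hx; exact hx.elim)
    (continuous_eval f)

/-- The band projection in `C(X)`, for extremally disconnected `X`: `projC b f` agrees with `f` on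
the closure of the cozero set of `b` and vanishes elsewhere. -/
def projC (b f : ofC X) : ofC X := mkC _ (continuous_indicator_closure_coz b f)

theorem eval_projC_of_mem {b : ofC X} (f : ofC X) {x : X} (hx : x ∈ closure (coz b)) :
    eval (projC b f) x = eval f x := Set.indicator_of_mem hx _

theorem eval_projC_of_notMem {b : ofC X} (f : ofC X) {x : X} (hx : x ∉ closure (coz b)) :
    eval (projC b f) x = 0 := Set.indicator_of_notMem hx _

/-- Split `x` into its band projection and the remainder. The projection lives on the closure of the
cozero set of `a`, where `a^⊥` vanishes; the remainder is zero there. -/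
theorem isProjectable_of_projC {A : Wstar.{u}} {ψ : Hom A (ofC X)} (hψ : Function.Injective ψ)
    (h : ∀ a b, ∃ d, ψ d = projC (ψ a) (ψ b)) : A.IsProjectable := by
  intro a x
  obtain ⟨y, hy⟩ := h a x
  refine ⟨y, ?_, x - y, ?_, (add_sub_cancel y x).symm⟩
  · intro s hs
    have hsa := (disjoint_iff_eval hψ).1 (hs a (Set.mem_singleton a))
    refine (disjoint_iff_eval hψ).2 fun t => ?_
    by_cases ht : t ∈ closure (coz (ψ a))
    · exact Or.inr (eval_eq_zero_of_mem_closure hsa ht)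
    · exact Or.inl (by rw [hy, eval_projC_of_notMem _ ht])
  · rintro s rfl
    refine (disjoint_iff_eval hψ).2 fun t => ?_
    by_cases ht : t ∈ closure (coz (ψ s))
    · exact Or.inl (by rw [ψ.map_sub, eval_sub, hy, eval_projC_of_mem _ ht, sub_self])
    · exact Or.inr (eval_eq_zero_of_notMem_closure ht)

/-- The range of a projectable essential extension in an essential extension `C(X)` is closed under
the band projections. -/
theorem exists_eq_projC {A B : Wstar.{u}} {φ : Hom A B} {ψ : Hom B (ofC X)}
    (hess : (ψ.comp φ).IsEssential) (hψ : Function.Injective ψ) (hB : B.IsProjectable) (b x : B) :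
    ∃ d, ψ d = projC (ψ b) (ψ x) := by
  obtain ⟨y, hy, z, hz, rfl⟩ := hB b x
  refine ⟨y, eval_ext fun e => ?_⟩
  have hzb := (disjoint_iff_eval hψ).1 (hz b (Set.mem_singleton b))
  by_cases he : e ∈ closure (coz (ψ b))
  · rw [eval_projC_of_mem _ he, ψ.map_add', eval_add, eval_eq_zero_of_mem_closure hzb he, add_zero]
  · rw [eval_projC_of_notMem _ he]
    -- Suppose `y` is nonzero off the closure of the cozero set of `b`. By irreducibility the open
    -- set of such points contains the preimage of a nonempty open `W`. An element of `A` with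
    -- cozero set in `W` is disjoint from `b` but not from `y`, against `y ∈ b^⊥⊥`.
    by_contra hne
    have hcover := (isEssential_iff_dual _).1 hess
    obtain ⟨W, hW, ⟨w, hw⟩, hWU⟩ := hcover.exists_open (U := (coz (ψ y) ∩ (closure (coz (ψ b)))ᶜ))
      ((isOpen_coz _).inter isClosed_closure.isOpen_compl) ⟨e, hne, he⟩
    obtain ⟨a, haw, haW⟩ := exists_cozero_subset (A := A) hW hw
    have hab : φ a ∈ polar {b} := by
      rintro _ rfl
      refine (disjoint_iff_eval hψ).2 fun t => ?_
      by_cases ht : eval (ψ (φ a)) t = 0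
      · exact Or.inl ht
      · have h1 : dual (ψ.comp φ) t ∈ W := haW _ (by rw [value_dual]; exact ht)
        exact Or.inr (eval_eq_zero_of_notMem_closure (hWU h1).2)
    obtain ⟨t, rfl⟩ := hcover.surjective w
    rcases (disjoint_iff_eval hψ).1 (hy _ hab) t with h1 | h1
    · exact (hWU (show t ∈ dual (ψ.comp φ) ⁻¹' W from hw)).1 h1
    · exact haw ((value_dual (ψ.comp φ) a t).trans h1)

end proj

theorem IsProjectable.of_bijective {A B : Wstar.{u}} {e : Hom A B} (he : Function.Bijective e)
    (hB : B.IsProjectable) : A.IsProjectable := by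
  obtain ⟨k, hek, hke⟩ := Hom.exists_inverse he
  have hdisj : ∀ x y : A, |x| ⊓ |y| = 0 ↔ |e x| ⊓ |e y| = 0 := by
    intro x y
    rw [← e.map_abs, ← e.map_abs, ← e.map_inf, ← e.map_zero]
    exact he.1.eq_iff.symm
  intro a x
  obtain ⟨y, hy, z, hz, hyz⟩ := hB (e a) (e x)
  refine ⟨k y, ?_, k z, ?_, he.1 ?_⟩
  · intro s hs
    rw [hdisj, hek]
    refine hy _ ?_
    rintro _ rfl
    rw [← hdisj]
    exact hs a (Set.mem_singleton a)
  · rintro s rfl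
    rw [hdisj, hek]
    exact hz _ (Set.mem_singleton _)
  · rw [e.map_add', hek, hek, hyz]

/-- Every object has a minimum projectable essential extension. -/
theorem exists_projectable_hull (A : Wstar.{u}) :
    ∃ Q : Under A, Q.map.IsEssential ∧ Q.obj.IsProjectable ∧
      ∀ P : Under A, P.map.IsEssential → P.obj.IsProjectable → Q ≤ P := by
  obtain ⟨E, p, hp, hE⟩ := OverSpace.exists_projective_cover A.yosidaSpace
  have := hE.extremallyDisconnected
  let φ : Hom A (ofC E) := (pullback p).comp (yosidaHom A)
  have hdual : dual φ = p := dual_pullback_comp_yosidaHom p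
  have hφ : φ.IsEssential := (isEssential_iff_dual φ).2 (by rw [hdual]; exact hp)
  have hcomp := generatedIncl_comp_generatedMap (projC (X := E)) φ
  refine ⟨⟨generated projC φ, generatedMap projC φ⟩, ?_, ?_, ?_⟩
  · refine Hom.IsEssential.of_comp (ψ := generatedIncl projC φ) ?_ generatedIncl_injective
    rw [hcomp]
    exact hφ
  · exact isProjectable_of_projC (ψ := generatedIncl projC φ) generatedIncl_injective
      fun a b => ⟨generatedOp projC φ a b, rfl⟩
  · intro P hP hPp
    have hcover := (isEssential_iff P.map).1 hP
    -- Projectivity lifts `E → YA` through `YP → YA`. The lift is onto by irreducibility, so it is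
    -- dual to an embedding of `P` in `C(E)` over `A`.
    obtain ⟨s, hs, hsp⟩ := hE p.continuous (yosidaMap P.map).continuous hcover.surjective
    let σ : C(E, P.obj.yosidaSpace) := ⟨s, hs⟩
    have hσ : (yosidaMap P.map).comp σ = p := ContinuousMap.ext (congrFun hsp)
    let ψ : Hom P.obj (ofC E) := (pullback σ).comp (yosidaHom P.obj)
    have hψφ : ψ.comp P.map = φ := by
      refine Hom.ext fun a => eval_ext fun x => ?_
      rw [← value_dual, ← value_dual, hdual, dual_comp, dual_pullback_comp_yosidaHom, hσ]
    have hψ : Function.Injective ψ := by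
      rw [injective_iff_dual_surjective, dual_pullback_comp_yosidaHom]
      exact hcover.surjective_of_comp (by rw [hσ]; exact hp.surjective)
    obtain ⟨l, hl⟩ := exists_generated_lift (op := projC) (φ := φ) (k := Hom.id _) (g := ψ) hψ
      (fun a => ⟨P.map a, Hom.congr hψφ a⟩) (by
        rintro _ _ ⟨b, rfl⟩ ⟨x, rfl⟩
        exact exists_eq_projC (by rw [hψφ]; exact hφ) hψ hPp b x)
    refine ⟨l, Hom.ext fun a => hψ ?_⟩
    refine (Hom.congr hψφ a).trans ((Hom.congr hcomp a).symm.trans ?_)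
    exact Hom.congr hl (generatedMap projC φ a)

end Wstar

theorem exists_isProjectableHull : ∃ p : HullAssignment.{u}, IsProjectableHull p := by
  choose p h1 h2 h3 using exists_projectable_hull.{u}
  exact ⟨p, h1, h2, h3⟩

namespace IsProjectableHull

variable {p : HullAssignment.{u}}

/-- `A` is a projectable essential extension of itself, so `p_A` has a left inverse; by essentiality
this is injective. -/
theorem fix_of_isProjectable (hp : IsProjectableHull p) {A : Wstar.{u}} (hA : A.IsProjectable) :
    p.Fix A := by
  obtain ⟨g, hg⟩ := hp.minimum A ⟨A, Hom.id A⟩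
    ⟨Function.injective_id, fun _ _ h => h⟩ hA
  have h1 : ∀ a, g ((p A).map a) = a := fun a => (Hom.congr hg a).symm
  have hinj : Function.Injective g := (hp.isEssential A).essential _ _ fun a b hab => by
    have hab' : g ((p A).map a) = g ((p A).map b) := hab
    rwa [h1, h1] at hab'
  exact ⟨Function.LeftInverse.injective h1, fun b => ⟨g b, hinj (h1 _)⟩⟩

theorem isHullOperator (hp : IsProjectableHull p) : IsHullOperator p where
  isEssential := hp.isEssential
  fix A := hp.fix_of_isProjectable (hp.isProjectable A)
  minimum A P hP hfix := hp.minimum A P hP (IsProjectable.of_bijective hfix (hp.isProjectable _))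

end IsProjectableHull

namespace Wstar

/-! ## An object that is not uniformly complete -/

/-- The sequences with finite range, as a linear space. -/
def finiteRange : Submodule ℝ (ULift.{u} ℕ → ℝ) where
  carrier := {f | (Set.range f).Finite}
  zero_mem' := (Set.finite_singleton (0 : ℝ)).subset (by rintro _ ⟨n, rfl⟩; rfl)
  add_mem' {f g} hf hg := (hf.image2 (· + ·) hg).subset (by
    rintro _ ⟨n, rfl⟩
    exact ⟨_, ⟨n, rfl⟩, _, ⟨n, rfl⟩, rfl⟩)
  smul_mem' r f hf := (hf.image (r * ·)).subset (by
    rintro _ ⟨n, rfl⟩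
    exact ⟨_, ⟨n, rfl⟩, rfl⟩)

theorem finiteRange_map₂ {f g : ULift.{u} ℕ → ℝ} (hf : f ∈ finiteRange) (hg : g ∈ finiteRange)
    (op : ℝ → ℝ → ℝ) : (fun n => op (f n) (g n)) ∈ finiteRange :=
  (Set.Finite.image2 op hf hg).subset (by
    rintro _ ⟨n, rfl⟩
    exact ⟨_, ⟨n, rfl⟩, _, ⟨n, rfl⟩, rfl⟩)

/-- The object of real sequences with finite range. -/
def simpleSeq : Wstar.{u} where
  carrier := (finiteRange.{u} : Submodule ℝ (ULift.{u} ℕ → ℝ))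
  instLattice := Subtype.lattice (fun _ _ hx hy => finiteRange_map₂ hx hy (· ⊔ ·))
    fun _ _ hx hy => finiteRange_map₂ hx hy (· ⊓ ·)
  instIsOrderedAddMonoid :=
    { add_le_add_left := fun a b h c n => add_le_add_left (show a.1 n ≤ b.1 n from h n) (c.1 n) }
  instPosSMulMono := ⟨fun r hr a b h n =>
    mul_le_mul_of_nonneg_left (show a.1 n ≤ b.1 n from h n) hr⟩
  archimedean f g hf h := by
    refine Subtype.ext (funext fun n => ?_)
    by_contra hne
    have hpos : 0 < f.1 n := lt_of_le_of_ne (hf n) (Ne.symm hne)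
    obtain ⟨k, hk⟩ := exists_nat_gt (g.1 n / f.1 n)
    have h1 : k • f.1 n ≤ g.1 n := h k n
    rw [nsmul_eq_mul] at h1
    rw [div_lt_iff₀ hpos] at hk
    linarith
  unit := ⟨fun _ => 1, (Set.finite_singleton (1 : ℝ)).subset (by rintro _ ⟨n, rfl⟩; rfl)⟩
  unit_nonneg := fun _ => zero_le_one
  strong f := by
    obtain ⟨c, hc⟩ := (f.2.image (fun t : ℝ => |t|)).bddAbove
    obtain ⟨k, hk⟩ := exists_nat_ge c
    refine ⟨k, fun n => ?_⟩
    have h1 : |f.1 n| ≤ c := hc ⟨_, ⟨n, rfl⟩, rfl⟩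
    have h2 : |f.1 n| ≤ k • (1 : ℝ) := by rw [nsmul_one]; exact h1.trans hk
    exact h2

/-- The `n`-th term of a sequence with finite range. -/
def term (f : simpleSeq.{u}) (n : ULift.{u} ℕ) : ℝ := f.1 n

/-- The sequence with finite range with the given terms. -/
def mkSeq (f : ULift.{u} ℕ → ℝ) (hf : f ∈ finiteRange) : simpleSeq.{u} := ⟨f, hf⟩

theorem simpleSeq_ext {f g : simpleSeq.{u}} (h : ∀ n, term f n = term g n) : f = g :=
  Subtype.ext (funext h)

theorem term_abs_inf_abs (f g : simpleSeq.{u}) (n : ULift.{u} ℕ) :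
    term (|f| ⊓ |g|) n = |term f n| ⊓ |term g n| := rfl

theorem disjoint_iff_term {f g : simpleSeq.{u}} :
    |f| ⊓ |g| = 0 ↔ ∀ n, term f n = 0 ∨ term g n = 0 := by
  simp only [← abs_inf_abs_eq_zero, ← term_abs_inf_abs]
  exact ⟨fun h n => congrArg (fun f => term f n) h, fun h => simpleSeq_ext h⟩

/-- Cutting `x` along the zero set of `a` leaves two sequences that still have finite range. -/
theorem isProjectable_simpleSeq : simpleSeq.{u}.IsProjectable := by
  intro a x
  have hy := finiteRange_map₂ a.2 x.2 fun s t => if s = 0 then 0 else t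
  have hz := finiteRange_map₂ a.2 x.2 fun s t => if s = 0 then t else 0
  refine ⟨mkSeq _ hy, ?_, mkSeq _ hz, ?_, simpleSeq_ext fun n => ?_⟩
  · intro s hs
    have hsa := disjoint_iff_term.1 (hs a (Set.mem_singleton a))
    refine disjoint_iff_term.2 fun n => ?_
    rcases hsa n with h | h
    · exact Or.inr h
    · exact Or.inl (if_pos h)
  · rintro s rfl
    refine disjoint_iff_term.2 fun n => ?_
    by_cases h : term s n = 0
    · exact Or.inr h
    · exact Or.inl (if_neg h)
  · change x.1 n = (if a.1 n = 0 then 0 else x.1 n) + (if a.1 n = 0 then x.1 n else 0)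
    split_ifs <;> simp

theorem isFRing_simpleSeq : simpleSeq.{u}.IsFRing := by
  refine ⟨LinearMap.mk₂ ℝ (fun f g => mkSeq _ (finiteRange_map₂ f.2 g.2 (· * ·))) ?_ ?_ ?_ ?_,
    ?_, ?_, ?_, ?_, ?_⟩
  · exact fun a b c => simpleSeq_ext fun n => add_mul (term a n) (term b n) (term c n)
  · exact fun r a b => simpleSeq_ext fun n => mul_assoc r (term a n) (term b n)
  · exact fun a b c => simpleSeq_ext fun n => mul_add (term a n) (term b n) (term c n)
  · exact fun r a b => simpleSeq_ext fun n => mul_left_comm (term a n) r (term b n)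
  all_goals simp only [LinearMap.mk₂_apply]
  · exact fun a b c => simpleSeq_ext fun n => mul_assoc (term a n) (term b n) (term c n)
  · exact fun a => simpleSeq_ext fun n => one_mul (term a n)
  · exact fun a => simpleSeq_ext fun n => mul_one (term a n)
  · exact fun a b ha hb n => mul_nonneg (ha n) (hb n)
  · intro a b c hab hc
    have hab' : ∀ n, term a n ⊓ term b n = 0 := fun n => congrArg (fun f => term f n) hab
    refine ⟨simpleSeq_ext fun n => mul_inf_eq_zero (hab' n) (hc n), simpleSeq_ext fun n => ?_⟩
    change (term a n * term c n) ⊓ term b n = 0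
    rw [mul_comm]
    exact mul_inf_eq_zero (hab' n) (hc n)

/-- The `k`-th unit sequence. -/
def unitSeq (k : ℕ) : simpleSeq.{u} :=
  mkSeq (fun n => if n.down = k then 1 else 0)
    ((Set.toFinite {(0 : ℝ), 1}).subset (by
      rintro _ ⟨n, rfl⟩
      dsimp only
      split_ifs <;> simp))

theorem term_unitSeq (k : ℕ) (n : ULift.{u} ℕ) :
    term (unitSeq k) n = if n.down = k then 1 else 0 := rfl

/-- The series of `2⁻ᵏ` times the `k`-th unit sequence converges uniformly on the Yosida space. A
preimage of its sum would have the terms `2⁻ⁿ`, which are infinitely many. -/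
theorem not_surjective_yosidaHom_simpleSeq : ¬ Function.Surjective (yosidaHom simpleSeq.{u}) := by
  intro hsurj
  let F : ℕ → C(MaxIdeal simpleSeq.{u}, ℝ) := fun k =>
    ((1 / 2 : ℝ) ^ k) • ⟨value (unitSeq k), continuous_value _⟩
  have hFv : ∀ k M, F k M = (1 / 2 : ℝ) ^ k * value (unitSeq k) M := fun _ _ => rfl
  have hval : ∀ k M, |value (unitSeq.{u} k) M| ≤ 1 := by
    intro k M
    rw [← value_abs, ← value_unit M]
    refine value_mono (fun n => ?_) M
    change |term (unitSeq k) n| ≤ 1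
    rw [term_unitSeq]
    split_ifs <;> simp
  have hsum : Summable F := by
    refine Summable.of_norm_bounded summable_geometric_two fun k => ?_
    refine (ContinuousMap.norm_le _ (by positivity)).2 fun M => ?_
    rw [hFv, Real.norm_eq_abs, abs_mul, abs_of_nonneg (by positivity : (0 : ℝ) ≤ (1 / 2) ^ k)]
    exact mul_le_of_le_one_right (by positivity) (hval k M)
  let G : C(MaxIdeal simpleSeq.{u}, ℝ) := ∑' k, F k
  obtain ⟨a, ha⟩ := hsurj G
  have hterm : ∀ n : ℕ, term a ⟨n⟩ = (1 / 2 : ℝ) ^ n := by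
    intro n
    -- Taking the `n`-th term is a character, so the sum can be evaluated at the corresponding
    -- point, where only the summand `k = n` survives.
    obtain ⟨M, hM⟩ := exists_maxIdeal_of_character (A := simpleSeq.{u})
      { toFun := fun f => term f ⟨n⟩
        map_add' := fun _ _ => rfl
        map_smul' := fun _ _ => rfl } (fun _ _ => rfl) rfl
    have hM' : ∀ f, value f M = term f ⟨n⟩ := hM
    have h1 : value a M = (∑' k, F k) M := congrArg (fun f : C(MaxIdeal simpleSeq.{u}, ℝ) => f M) ha
    rw [← hM', h1, ← ContinuousMap.tsum_apply hsum, tsum_eq_single n]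
    · rw [hFv, hM', term_unitSeq, if_pos rfl, mul_one]
    · intro k hk
      rw [hFv, hM', term_unitSeq, if_neg (Ne.symm hk), mul_zero]
  have hinj : Function.Injective fun n : ℕ => (1 / 2 : ℝ) ^ n :=
    pow_right_injective₀ (by norm_num) (by norm_num)
  refine Set.infinite_range_of_injective hinj (a.2.subset ?_)
  rintro _ ⟨n, rfl⟩
  exact ⟨⟨n⟩, hterm n⟩

end Wstar

/-! ### Operators outside the range of `μ` -/

theorem not_antisymmRel_mu {c : CoverAssignment.{u}} (hc : IsCoveringOperator c)
    {h : HullAssignment.{u}} (hfix : h.Fix simpleSeq) : ¬ AntisymmRel (· ≤ ·) (mu c) h :=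
  fun hle => not_surjective_yosidaHom_simpleSeq (yosidaHom_bijective_of_mu_le hc hle.1 hfix).2

end

end

theorem mainTheorem12 :
    -- Two (covering or hull) operators count as equal when each is `≤` the other, that is, when
    -- they pick equivalent covers (extensions) at every object.
    -- `μ` maps covering operators to hull operators, and these lie above the hull operator `u`
    (IsHullOperator uniformCompletion.{u} ∧
      ∀ c : CoverAssignment.{u}, IsCoveringOperator c →
        IsHullOperator (mu c) ∧ uniformCompletion.{u} ≤ mu c) ∧
    -- `μ` is order-preserving
    (∀ c d : CoverAssignment.{u}, IsCoveringOperator c → IsCoveringOperator d →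
      c ≤ d → mu c ≤ mu d) ∧
    -- `μ` is injective
    (∀ c d : CoverAssignment.{u}, IsCoveringOperator c → IsCoveringOperator d →
      AntisymmRel (· ≤ ·) (mu c) (mu d) → AntisymmRel (· ≤ ·) c d) ∧
    -- `μ` is not onto
    (∃ h : HullAssignment.{u}, IsHullOperator h ∧
      ∀ c : CoverAssignment.{u}, IsCoveringOperator c → ¬ AntisymmRel (· ≤ ·) (mu c) h) ∧
    -- the ring reflection is a hull operator and not in the range of `μ`
    ((∃ r : HullAssignment.{u}, IsRingReflection r) ∧
      ∀ r : HullAssignment.{u}, IsRingReflection r → IsHullOperator r ∧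
        ∀ c : CoverAssignment.{u}, IsCoveringOperator c → ¬ AntisymmRel (· ≤ ·) (mu c) r) ∧
    -- the projectable hull is a hull operator and not in the range of `μ`
    ((∃ p : HullAssignment.{u}, IsProjectableHull p) ∧
      ∀ p : HullAssignment.{u}, IsProjectableHull p → IsHullOperator p ∧
        ∀ c : CoverAssignment.{u}, IsCoveringOperator c → ¬ AntisymmRel (· ≤ ·) (mu c) p) := by
  have hr : ∀ r : HullAssignment.{u}, IsRingReflection r → IsHullOperator r ∧
      ∀ c : CoverAssignment.{u}, IsCoveringOperator c → ¬ AntisymmRel (· ≤ ·) (mu c) r :=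
    fun r hr => ⟨hr.isHullOperator, fun c hc =>
      not_antisymmRel_mu hc (hr.fix_of_isFRing Wstar.isFRing_simpleSeq)⟩
  have hp : ∀ p : HullAssignment.{u}, IsProjectableHull p → IsHullOperator p ∧
      ∀ c : CoverAssignment.{u}, IsCoveringOperator c → ¬ AntisymmRel (· ≤ ·) (mu c) p :=
    fun p hp => ⟨hp.isHullOperator, fun c hc =>
      not_antisymmRel_mu hc (hp.fix_of_isProjectable Wstar.isProjectable_simpleSeq)⟩
  refine ⟨⟨isHullOperator_uniformCompletion, fun c hc =>
      ⟨isHullOperator_mu hc, uniformCompletion_le_mu c⟩⟩, fun c d _ _ h => mu_mono h,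
    fun c d hc hd h => ⟨le_of_mu_le_mu hc hd h.1, le_of_mu_le_mu hd hc h.2⟩, ?_,
    ⟨exists_isRingReflection, hr⟩, ⟨exists_isProjectableHull, hp⟩⟩
  obtain ⟨r, h⟩ := exists_isRingReflection.{u}
  exact ⟨r, hr r h⟩
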